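/- Let $K$ be a field of characteristic zero. Equip every $K[[h]]$-module with its $h$-adic topology; for a $K$-vector space $V_0$ (resp. $K$-algebra) let $V_0[[h]]$ be the $K[[h]]$-module (resp. algebra) of formal series $\sum_{m\ge 0} v_m h^m$ with $v_m\in V_0$. A sequence $f=(f^k)_{k\ge d}$ of families $f^k=(f^k(n))_{n\in\mathbb Z}$ in $K[[h]]$ is *summable* if for every $m$ there is $N$ such that $h^m$ divides $f^k(n)$ for all $k\ge N$ and all $n\in\mathbb Z$. It is *regular* if there is a summable sequence $g=(g^a)_{a\ge 0}$ with $f^k(n)=\sum_{a\ge 0} g^a(k)\,n^a$ for all $k\ge d$, $n\in\mathbb Z$. For regular $f$ each $f^k$ is interpolated by a unique element of $K[T][[h]]$, and $f^k(H)$ denotes the value of this element at $T=H$ (coefficientwise in $h$). A *colouring* is a sequence $\psi=(\psi^k)_{k\ge 1}$ of families $\psi^k=(\psi^k(n))_{n\in\mathbb Z}$ in $K[[h]]$ such that $\psi^k(n)\equiv k(n-k+1) \bmod h$ for all $k\ge 1$, $n\in\mathbb Z$; $\psi^{n+1}(n)=0$ for all $n\ge 0$; and $\psi^{n+k+1}(n)=\psi^k(-n-2)$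 for all $k\ge 1$, $n\ge 0$. Let $U(\mathfrak a)$ be the $K$-algebra generated by $H,X^-,X^+$ subject to $[H,X^\pm]=\pm 2X^\pm$. For $n\in\mathbb Z$ let $M_h(n,\psi)$ be the representation of $U(\mathfrak a)[[h]]$ on $\big(\bigoplus_{k\ge 0}K b_k\big)[[h]]$ given by $$H b_k=(n-2k)b_k,\qquad X^- b_k=b_{k+1},\qquad X^+b_0=0,\qquad X^+b_k=\psi^k(n)\,b_{k-1}\ (k\ge 1).$$ Let $U_h(\psi)$ be the quotient of $U(\mathfrak a)[[h]]$ by the two-sided ideal of all elements acting by zero on $M_h(n,\psi)$ for every $n\in\mathbb Z$. **Theorem.** Let $\psi$ be a regular colouring. 1. There is a unique regular summable sequence $\xi=(\xi^a)_{a\ge 0}$ such that $$\sum_{a=0}^k\Big(\prod_{b=k-a+1}^k\psi^b(n)\Big)\,\xi^a(n-2k)=\psi^{k+1}(n)\qquad\text{for all } k\ge 0,\ n\in\mathbb Z .$$ 2. The $K[[h]]$-algebra $U_h(\psi)$ is topologically generated by $H,X^-,X^+$ and subject to the relations $$[H,X^\pm]=\pm 2X^\pm,\qquad X^+X^-=\sum_{a=0}^\infty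 (X^-)^a(X^+)^a\,\xi^a(H).$$ That is: the $K[[h]]$-subalgebra generated by $H,X^-,X^+$ is dense in $U_h(\psi)$; these relations hold in $U_h(\psi)$, with a convergent series; the series $\sum_{a}(X^-)^a(X^+)^a\xi^a(H)$ also converges in $K\langle H,X^-,X^+\rangle[[h]]$; and the quotient of $K\langle H,X^-,X^+\rangle[[h]]$ by the smallest closed two-sided ideal containing the relations is isomorphic to $U_h(\psi)$ as a $K[[h]]$-algebra, by an isomorphism sending $H,X^-,X^+$ to $H,X^-,X^+$. -/

import Mathlib

namespace ColouredKM

open scoped PowerSeries Polynomial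
open Filter
open Finset.HasAntidiagonal (antidiagonal mem_antidiagonal)

noncomputable section

/-! ### Formal series with coefficients in modules and algebras

The variable of `K⟦X⟧` plays the role of `h`. -/

section Series

variable (K : Type*) [Field K]

/-- For a `K`-algebra `A` (not necessarily commutative), the `K⟦h⟧`-algebra structure of `A⟦h⟧`. -/
@[reducible]
def hAlgebra (A : Type*) [Semiring A] [Algebra K A] : Algebra K⟦X⟧ A⟦X⟧ :=
  (PowerSeries.map (algebraMap K A)).toAlgebra' fun c x => by
    ext m
    rw [PowerSeries.coeff_mul, PowerSeries.coeff_mul]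
    refine Finset.sum_bij' (fun p _ => p.swap) (fun p _ => p.swap) ?_ ?_ ?_ ?_ ?_ <;>
      simp [add_comm, Algebra.commutes]

/-- The `h`-adic topology of a `K⟦h⟧`-module: the submodules `h^m M` form a base at zero. -/
@[reducible]
def hTopology (M : Type*) [AddCommGroup M] [Module K⟦X⟧ M] : TopologicalSpace M :=
  (Ideal.span {(PowerSeries.X : K⟦X⟧)}).adicModuleTopology M

/-- The series `∑_{a ≥ 0} f a` converges to `s` for the `h`-adic topology. -/
def HasHSum {M : Type*} [AddCommGroup M] [Module K⟦X⟧ M] (f : ℕ → M) (s : M) : Prop :=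
  Tendsto (fun N => ∑ a ∈ Finset.range N, f a) atTop (@nhds M (hTopology K M) s)

/-- `A'` topologically generates the `K⟦h⟧`-algebra `A`: the closure of the `K⟦h⟧`-subalgebra
generated by `A'` is `A`. -/
def TopologicallyGenerates {A : Type*} [Ring A] [Algebra K⟦X⟧ A] (A' : Set A) : Prop :=
  @closure A (hTopology K A) (Algebra.adjoin K⟦X⟧ A' : Set A) = Set.univ

/-- The smallest `h`-adically closed two-sided ideal containing `S`. -/
def closedIdeal {A : Type*} [Ring A] [Algebra K⟦X⟧ A] (S : Set A) : Ideal A :=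
  sInf {I : Ideal A | I.IsTwoSided ∧ @IsClosed A (hTopology K A) (I : Set A) ∧ S ⊆ I}

instance closedIdeal_isTwoSided {A : Type*} [Ring A] [Algebra K⟦X⟧ A] (S : Set A) :
    (closedIdeal K S).IsTwoSided where
  mul_mem_of_left b ha := by
    rw [closedIdeal, Submodule.mem_sInf] at ha ⊢
    intro I hI
    have := hI.1
    exact Ideal.IsTwoSided.mul_mem_of_left b (ha I hI)

end Series

/-- `V⟦h⟧` for a module `V`: the formal series `∑ v_m h^m`, encoded by `m ↦ v_m`. -/
def HSeries (V : Type*) : Type _ := ℕ → V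

namespace HSeries

instance (V : Type*) [AddCommGroup V] : AddCommGroup (HSeries V) :=
  inferInstanceAs (AddCommGroup (ℕ → V))

@[ext]
theorem ext {V : Type*} {v w : HSeries V} (hvw : ∀ m, v m = w m) : v = w := funext hvw

theorem add_apply {V : Type*} [AddCommGroup V] (v w : HSeries V) (m : ℕ) :
    (v + w) m = v m + w m := rfl

theorem zero_apply {V : Type*} [AddCommGroup V] (m : ℕ) : (0 : HSeries V) m = 0 := rfl

/-- If `A` acts on `V`, then `A⟦h⟧` acts on `V⟦h⟧` by
`(∑ a_i h^i) (∑ v_j h^j) = ∑ (a_i v_j) h^(i+j)`. -/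
instance (A V : Type*) [Semiring A] [AddCommGroup V] [Module A V] : SMul A⟦X⟧ (HSeries V) where
  smul x v := fun m => ∑ p ∈ antidiagonal m, PowerSeries.coeff p.1 x • v p.2

theorem smul_apply {A V : Type*} [Semiring A] [AddCommGroup V] [Module A V] (x : A⟦X⟧)
    (v : HSeries V) (m : ℕ) :
    (x • v) m = ∑ p ∈ antidiagonal m, PowerSeries.coeff p.1 x • v p.2 := rfl

instance (A V : Type*) [Semiring A] [AddCommGroup V] [Module A V] : Module A⟦X⟧ (HSeries V) where
  one_smul v := by
    ext m
    rw [smul_apply, Finset.sum_eq_single (0, m)]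
    · simp
    · rintro ⟨i, j⟩ hp hne
      have hi : i ≠ 0 := by
        rintro rfl
        simp at hp
        exact hne (by simp [hp])
      simp [PowerSeries.coeff_one, hi]
    · simp
  mul_smul x y v := by
    ext m
    simp only [smul_apply, PowerSeries.coeff_mul, Finset.sum_smul, Finset.smul_sum, mul_smul]
    rw [Finset.sum_sigma', Finset.sum_sigma']
    refine Finset.sum_bij' (fun p _ => ⟨(p.2.1, p.2.2 + p.1.2), (p.2.2, p.1.2)⟩)
      (fun p _ => ⟨(p.1.1 + p.2.1, p.2.2), (p.1.1, p.2.1)⟩) ?_ ?_ ?_ ?_ ?_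
    all_goals
      rintro ⟨⟨i, j⟩, ⟨s, t⟩⟩ hp
      simp only [Finset.mem_sigma, mem_antidiagonal] at hp
      obtain ⟨rfl, rfl⟩ := hp
      simp [add_assoc]
  smul_zero x := by ext m; simp [smul_apply, zero_apply]
  zero_smul v := by ext m; simp [smul_apply, zero_apply]
  smul_add x v w := by
    ext m
    simp [smul_apply, add_apply, Finset.sum_add_distrib]
  add_smul x y v := by
    ext m
    simp [smul_apply, add_apply, Finset.sum_add_distrib, add_smul]

end HSeries

/-! ### The algebra `U(𝔞)⟦h⟧` -/

/-- Names of the generators `H`, `X⁻`, `X⁺`. -/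
inductive Gen
  | H
  | Xm
  | Xp

section Algebras

variable (K : Type*) [Field K]

/-- The free associative algebra `K⟨H, X⁻, X⁺⟩`. -/
abbrev Free := FreeAlgebra K Gen

/-- The non-deformed relations `[H, X⁺] = 2 X⁺` and `[H, X⁻] = -2 X⁻`. -/
inductive NonDeformed : Free K → Free K → Prop
  | plus : NonDeformed
      (FreeAlgebra.ι K Gen.H * FreeAlgebra.ι K Gen.Xp
        - FreeAlgebra.ι K Gen.Xp * FreeAlgebra.ι K Gen.H)
      (2 * FreeAlgebra.ι K Gen.Xp)
  | minus : NonDeformed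
      (FreeAlgebra.ι K Gen.H * FreeAlgebra.ι K Gen.Xm
        - FreeAlgebra.ι K Gen.Xm * FreeAlgebra.ι K Gen.H)
      (-(2 * FreeAlgebra.ι K Gen.Xm))

/-- `U(𝔞)`, the `K`-algebra generated by `H, X⁻, X⁺` subject to the non-deformed relations. -/
def Ua : Type _ := RingQuot (NonDeformed K)

instance : Ring (Ua K) := inferInstanceAs (Ring (RingQuot (NonDeformed K)))

instance : Algebra K (Ua K) := inferInstanceAs (Algebra K (RingQuot (NonDeformed K)))

/-- The generators of `U(𝔞)`. -/
def Ua.gen (g : Gen) : Ua K := RingQuot.mkAlgHom K (NonDeformed K) (FreeAlgebra.ι K g)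

/-- `K⟨H, X⁻, X⁺⟩⟦h⟧`. -/
abbrev FreeH := (Free K)⟦X⟧

instance : Algebra K⟦X⟧ (FreeH K) := hAlgebra K (Free K)

/-- The generators of `K⟨H, X⁻, X⁺⟩⟦h⟧`, as constant series. -/
def FreeH.gen (g : Gen) : FreeH K := PowerSeries.C (FreeAlgebra.ι K g)

/-- `U_h(𝔞) = U(𝔞)⟦h⟧`. -/
abbrev Uha := (Ua K)⟦X⟧

instance : Algebra K⟦X⟧ (Uha K) := hAlgebra K (Ua K)

/-- The generators of `U_h(𝔞)`, as constant series. -/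
def Uha.gen (g : Gen) : Uha K := PowerSeries.C (Ua.gen K g)

end Algebras

/-- `p(x) ∈ A⟦h⟧` for `p ∈ K[T]⟦h⟧` and `x ∈ A`. -/
def evalSeries {K A : Type*} [Field K] [Ring A] [Algebra K A] (x : A) (p : K[X]⟦X⟧) : A⟦X⟧ :=
  PowerSeries.map (Polynomial.aeval x : K[X] →ₐ[K] A).toRingHom p

/-- The `h`-linear extension `A⟦h⟧ → B⟦h⟧`, `∑ x_m h^m ↦ ∑ φ(x_m) h^m`, of an algebra
homomorphism `φ : A → B⟦h⟧`. -/
def hExtend {K A B : Type*} [Field K] [Semiring A] [Algebra K A] [Semiring B] [Algebra K B]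
    (φ : A →ₐ[K] B⟦X⟧) : A⟦X⟧ →+* B⟦X⟧ where
  toFun x := PowerSeries.mk fun m =>
    ∑ p ∈ antidiagonal m, PowerSeries.coeff p.2 (φ (PowerSeries.coeff p.1 x))
  map_one' := by
    ext m
    rw [PowerSeries.coeff_mk, Finset.sum_eq_single (0, m)]
    · simp
    · rintro ⟨i, j⟩ hp hne
      have hi : i ≠ 0 := by
        rintro rfl
        simp at hp
        exact hne (by simp [hp])
      simp [PowerSeries.coeff_one, hi]
    · simp
  map_zero' := by ext m; simp
  map_add' x y := by ext m; simp [Finset.sum_add_distrib]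
  map_mul' x y := by
    ext m
    simp only [PowerSeries.coeff_mk, PowerSeries.coeff_mul, map_sum, map_mul,
      Finset.sum_mul_sum, Finset.sum_sigma']
    refine Finset.sum_bij'
      (fun p _ => ⟨(p.2.1.1 + p.2.2.1, p.2.1.2 + p.2.2.2),
        ⟨(p.2.1.1, p.2.2.1), (p.2.1.2, p.2.2.2)⟩⟩)
      (fun p _ => ⟨(p.2.1.1 + p.2.2.1, p.2.1.2 + p.2.2.2),
        ⟨(p.2.1.1, p.2.2.1), (p.2.1.2, p.2.2.2)⟩⟩) ?_ ?_ ?_ ?_ ?_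
    all_goals
      rintro ⟨⟨s, t⟩, ⟨⟨i, j⟩, ⟨p, q⟩⟩⟩ hp
      simp only [Finset.mem_sigma, mem_antidiagonal] at hp
      obtain ⟨rfl, rfl, rfl⟩ := hp
      simp [add_assoc, add_left_comm]

/-! ### Sequences with values in `K^ℤ⟦h⟧` and colourings

A sequence `(f^k)_{k ≥ d}` with values in `K^ℤ⟦h⟧` is encoded by `f : ℕ → ℤ → K⟦X⟧`, with
`f k n = f^k(n)`; the values at `k < d` are irrelevant. -/

section Colourings

variable {K : Type*} [Field K]

/-- `f^k` tends to zero in `K^ℤ⟦h⟧` for the `h`-adic topology as `k` goes to infinity. As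
`h^m K^ℤ⟦h⟧` consists of the families in `K⟦h⟧` all of whose members are divisible by `h^m`, this
is uniform in `n`. -/
def IsSummableSeq (f : ℕ → ℤ → K⟦X⟧) : Prop :=
  ∀ m : ℕ, ∃ N : ℕ, ∀ k ≥ N, ∀ n : ℤ, (PowerSeries.X : K⟦X⟧) ^ m ∣ f k n

/-- Regularity of a sequence `(f^k)_{k ≥ d}`: there is a summable `g` such that
`f^k(n) = ∑_{a ≥ 0} g^a(k) n^a` for all `k ≥ d` and all `n`. -/
def IsRegularSeq (d : ℕ) (f : ℕ → ℤ → K⟦X⟧) : Prop :=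
  ∃ g : ℕ → ℤ → K⟦X⟧, IsSummableSeq g ∧
    ∀ k ≥ d, ∀ n : ℤ, HasHSum K (fun a => g a k * (n : K⟦X⟧) ^ a) (f k n)

variable (K) in
/-- A colouring `ψ = (ψ^k)_{k ≥ 1}`; the value of `toFun` at `k = 0` is irrelevant. -/
structure Colouring where
  toFun : ℕ → ℤ → K⟦X⟧
  c1 : ∀ k ≥ 1, ∀ n : ℤ, PowerSeries.constantCoeff (toFun k n) = (k : K) * ((n : K) - k + 1)
  c2 : ∀ n : ℕ, toFun (n + 1) n = 0
  c3 : ∀ k ≥ 1, ∀ n : ℕ, toFun (n + k + 1) n = toFun k (-n - 2)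

/-- `(ψ ⋉ ξ)^k(n) = ∑_{a=0}^k (∏_{b=k-a+1}^k ψ^b(n)) ξ^a(n-2k)`. -/
def ltimes (ψ : Colouring K) (ξ : ℕ → ℤ → K⟦X⟧) (k : ℕ) (n : ℤ) : K⟦X⟧ :=
  ∑ a ∈ Finset.range (k + 1), (∏ b ∈ Finset.Icc (k - a + 1) k, ψ.toFun b n) * ξ a (n - 2 * k)

/-- `ψ[+1]`, the sequence `(ψ^{k+1})_{k ≥ 0}`. -/
def Colouring.shift (ψ : Colouring K) (k : ℕ) (n : ℤ) : K⟦X⟧ := ψ.toFun (k + 1) n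

/-- `ξ` is a regular summable solution `(ξ^a)_{a ≥ 0}` of the equation `ψ ⋉ ξ = ψ[+1]`. -/
def IsRegularSolution (ψ : Colouring K) (ξ : ℕ → ℤ → K⟦X⟧) : Prop :=
  IsSummableSeq ξ ∧ IsRegularSeq 0 ξ ∧ ltimes ψ ξ = ψ.shift

/-- `p^a ∈ K[T]⟦h⟧` interpolates `ξ^a`, that is `ξ^a(n) = p^a(n)` for all `n`. For such `p`, the
element `ξ^a(H)` is `evalSeries H (p a)`. -/
def Interpolates (p : ℕ → K[X]⟦X⟧) (ξ : ℕ → ℤ → K⟦X⟧) : Prop :=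
  ∀ (a : ℕ) (n : ℤ), PowerSeries.map (Polynomial.evalRingHom (n : K)) (p a) = ξ a n

end Colourings

/-! ### Deformed Verma modules -/

section Verma

variable {K : Type*} [Field K]

/-- The `K`-vector space `⨁_{k ≥ 0} K b_k`. -/
abbrev V₀ (K : Type*) [Field K] := ℕ →₀ K

instance : Algebra K⟦X⟧ (Module.End K (V₀ K))⟦X⟧ := hAlgebra K (Module.End K (V₀ K))

theorem algebraMap_smul_eq (c : K⟦X⟧) (v : HSeries (V₀ K)) :
    algebraMap K⟦X⟧ (Module.End K (V₀ K))⟦X⟧ c • v = c • v := by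
  ext1 m
  rw [HSeries.smul_apply, HSeries.smul_apply]
  refine Finset.sum_congr rfl fun p _ => ?_
  change PowerSeries.coeff p.1 (PowerSeries.map (algebraMap K (Module.End K (V₀ K))) c) • v p.2 = _
  rw [PowerSeries.coeff_map]
  rfl

instance : IsScalarTower K⟦X⟧ (Module.End K (V₀ K))⟦X⟧ (HSeries (V₀ K)) where
  smul_assoc c x v := by
    rw [Algebra.smul_def, mul_smul, algebraMap_smul_eq]

instance : SMulCommClass (Module.End K (V₀ K))⟦X⟧ K⟦X⟧ (HSeries (V₀ K)) where
  smul_comm x c v := by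
    rw [← algebraMap_smul_eq c v, ← algebraMap_smul_eq c (x • v), smul_smul, smul_smul,
      Algebra.commutes]

/-- The operator `b_k ↦ (n - 2k) b_k`. -/
def opH (n : ℤ) : Module.End K (V₀ K) :=
  Finsupp.lsum ℕ fun k : ℕ => ((n : K) - 2 * k) • Finsupp.lsingle k

/-- The operator `b_k ↦ b_{k+1}`. -/
def opXm : Module.End K (V₀ K) :=
  Finsupp.lsum ℕ fun k : ℕ => Finsupp.lsingle (k + 1)

/-- The operator `b_0 ↦ 0`, `b_{k+1} ↦ c_{k+1} b_k`. -/
def opXp (c : ℕ → K) : Module.End K (V₀ K) :=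
  Finsupp.lsum ℕ fun k : ℕ => if k = 0 then 0 else c k • Finsupp.lsingle (k - 1)

theorem opH_single (n : ℤ) (k : ℕ) (x : K) :
    opH n (Finsupp.single k x) = ((n : K) - 2 * k) • Finsupp.single k x := by
  simp [opH]

theorem opXm_single (k : ℕ) (x : K) :
    opXm (Finsupp.single k x) = Finsupp.single (k + 1) x := by
  simp [opXm]

theorem opXp_single_zero (c : ℕ → K) (x : K) : opXp c (Finsupp.single 0 x) = 0 := by
  simp [opXp]

theorem opXp_single_succ (c : ℕ → K) (k : ℕ) (x : K) :
    opXp c (Finsupp.single (k + 1) x) = c (k + 1) • Finsupp.single k x := by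
  simp [opXp]

/-- The operators by which the generators act on the deformed Verma module of highest weight `n`,
as elements of `End(⨁ K b_k)⟦h⟧`: `H b_k = (n - 2k) b_k`, `X⁻ b_k = b_{k+1}`, `X⁺ b_0 = 0` and
`X⁺ b_k = ψ^k(n) b_{k-1}` for `k ≥ 1`. -/
def vermaGen (ψ : Colouring K) (n : ℤ) : Gen → (Module.End K (V₀ K))⟦X⟧
  | Gen.H => PowerSeries.C (opH n)
  | Gen.Xm => PowerSeries.C opXm
  | Gen.Xp => PowerSeries.mk fun m => opXp fun k => PowerSeries.coeff m (ψ.toFun k n)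

theorem vermaGen_rel (ψ : Colouring K) (n : ℤ) ⦃x y : Free K⦄ (hxy : NonDeformed K x y) :
    FreeAlgebra.lift K (vermaGen ψ n) x = FreeAlgebra.lift K (vermaGen ψ n) y := by
  cases hxy with
  | plus =>
    simp only [two_mul, map_add, map_sub, map_mul, FreeAlgebra.lift_ι_apply]
    ext m : 1
    simp only [vermaGen, map_add, map_sub, PowerSeries.coeff_C_mul, PowerSeries.coeff_mul_C,
      PowerSeries.coeff_mk]
    refine Finsupp.lhom_ext fun k x => ?_
    rcases k with _ | k
    · simp only [LinearMap.sub_apply, LinearMap.add_apply, Module.End.mul_apply, opH_single,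
        opXp_single_zero, map_smul, map_zero, smul_zero, sub_zero, add_zero]
    · simp only [LinearMap.sub_apply, LinearMap.add_apply, Module.End.mul_apply, opH_single,
        opXp_single_succ, map_smul]
      push_cast
      module
  | minus =>
    simp only [two_mul, map_add, map_sub, map_neg, map_mul, FreeAlgebra.lift_ι_apply]
    simp only [vermaGen, ← map_mul, ← map_sub, ← map_add, ← map_neg]
    congr 1
    refine Finsupp.lhom_ext fun k x => ?_
    simp only [LinearMap.sub_apply, LinearMap.add_apply, LinearMap.neg_apply,
      Module.End.mul_apply, opH_single, opXm_single, map_smul]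
    push_cast
    module

/-- The action of `U(𝔞)` on the deformed Verma module. -/
def vermaHom (ψ : Colouring K) (n : ℤ) : Ua K →ₐ[K] (Module.End K (V₀ K))⟦X⟧ :=
  RingQuot.liftAlgHom K ⟨FreeAlgebra.lift K (vermaGen ψ n), vermaGen_rel ψ n⟩

/-- The representation of `U_h(𝔞)` on the deformed Verma module `(⨁ K b_k)⟦h⟧` of highest weight
`n` associated to `ψ`. -/
def vermaRep (ψ : Colouring K) (n : ℤ) :
    Uha K →+* Module.End K⟦X⟧ (HSeries (V₀ K)) :=
  (Algebra.lsmul K⟦X⟧ K⟦X⟧ (HSeries (V₀ K)) :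
    (Module.End K (V₀ K))⟦X⟧ →ₐ[K⟦X⟧] _).toRingHom.comp (hExtend (vermaHom ψ n))

/-- The two-sided ideal of `U_h(𝔞)` formed by the elements acting by zero on all the deformed Verma
modules associated to `ψ`. -/
def vermaIdeal (ψ : Colouring K) : Ideal (Uha K) := ⨅ n : ℤ, RingHom.ker (vermaRep ψ n)

theorem mem_vermaIdeal (ψ : Colouring K) (x : Uha K) :
    x ∈ vermaIdeal ψ ↔ ∀ n : ℤ, ∀ v : HSeries (V₀ K), vermaRep ψ n x v = 0 := by
  simp [vermaIdeal, Submodule.mem_iInf, RingHom.mem_ker, LinearMap.ext_iff]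

instance (ψ : Colouring K) : (vermaIdeal ψ).IsTwoSided where
  mul_mem_of_left b ha := by
    rw [mem_vermaIdeal] at ha ⊢
    intro n v
    rw [map_mul, Module.End.mul_apply, ha]

/-- The algebra `U_h(ψ)`. -/
abbrev Uh (ψ : Colouring K) := Uha K ⧸ vermaIdeal ψ

/-- The generators of `U_h(ψ)`. -/
def Uh.gen (ψ : Colouring K) (g : Gen) : Uh ψ := Ideal.Quotient.mk (vermaIdeal ψ) (Uha.gen K g)

end Verma

/-! ### The presentation -/

section Presentation

variable {K : Type*} [Field K]

/-- The relators `[H, X⁺] - 2 X⁺`, `[H, X⁻] + 2 X⁻` and `X⁺ X⁻ - r` in `K⟨H, X⁻, X⁺⟩⟦h⟧`. -/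
def relators (r : FreeH K) : Set (FreeH K) :=
  {FreeH.gen K Gen.H * FreeH.gen K Gen.Xp - FreeH.gen K Gen.Xp * FreeH.gen K Gen.H
      - 2 * FreeH.gen K Gen.Xp,
    FreeH.gen K Gen.H * FreeH.gen K Gen.Xm - FreeH.gen K Gen.Xm * FreeH.gen K Gen.H
      + 2 * FreeH.gen K Gen.Xm,
    FreeH.gen K Gen.Xp * FreeH.gen K Gen.Xm - r}

/-- The `K⟦h⟧`-algebra topologically generated by `H, X⁻, X⁺` and subject to the relations
`[H, X⁺] = 2 X⁺`, `[H, X⁻] = -2 X⁻` and `X⁺ X⁻ = r`: the quotient of `K⟨H, X⁻, X⁺⟩⟦h⟧` by the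
smallest `h`-adically closed two-sided ideal containing these relations. -/
abbrev Presented (r : FreeH K) := FreeH K ⧸ closedIdeal K (relators r)

end Presentation

end

end ColouredKM

open scoped PowerSeries Polynomial

namespace ColouredKM

open scoped PowerSeries Polynomial
open Filter
open Finset.HasAntidiagonal (antidiagonal mem_antidiagonal)

noncomputable section

/-! ### The `h`-adic topology -/

section Topology

variable {K : Type*} [Field K] {M : Type*} [AddCommGroup M] [Module K⟦X⟧ M]

/-! Existence of ξ. In terms of N = n - 2k, the weight of b_k, the equation becomes one identity in
K[N]⟦h⟧ for each k. By `c2` and `c3`, for n ≥ 0 the vector b_{n+1} generates a copy of M_h(-n-2, ψ)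
inside M_h(n, ψ). Hence the coefficients and the right-hand side are sequences (G_k) with G_k = G_j
at N = -j-k-1, and regularity bounds their degrees uniformly in k at each order in h
(`symmetricSeq`). Modulo h the coefficient of ξ^a is ∏_{i<a} (k-i)(N+k+i+1) = ∏_{i<a} (k(N+k+1) -
i(N+i+1)), a Newton basis in the variable k(N+k+1). Every bounded symmetric sequence is a finite
K[N]-combination of these products (`exists_newton_expansion`), so the equation can be solved order
by order in h (`exists_series_solution`, `IsInterpolation.exists_solution`).

Uniqueness of ξ. For n < 0 no ψ^b(n) with b ≥ 1 vanishes modulo h, so the k-th equation determines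
ξ^k(N) from the earlier ξ^a for all N < -2k, which fixes the interpolating series.

Presentation. On b_k only the terms a ≤ k of the series act, and the equation for ξ says precisely
that their sum acts as X⁺X⁻ (`freeAct_Xp_mul_Xm`). Conversely, ξ ≡ (T, 1, 0, …) modulo h, so modulo
h the relations are those of sl₂. They reduce every element to a combination of monomials (X⁻)^a
(X⁺)^b H^c (`mem_pbwSpan`), and no nonzero combination acts by zero modulo h on all the Verma
modules (`eq_zero_of_mem_pbwSpan`). An element of the kernel of K⟨H, X⁻, X⁺⟩⟦h⟧ → U_h(ψ) is thus a
relation plus h times an element which again lies in the kernel, U_h(ψ) being h-torsion free.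
Iterating, it lies in the closure of the ideal of relations (`ker_toUh_le_closedIdeal`). -/

theorem hTopology_hasBasis (x : M) :
    (@nhds M (hTopology K M) x).HasBasis (fun _ : ℕ => True)
      fun m => {y | ∃ z : M, y - x = (PowerSeries.X : K⟦X⟧) ^ m • z} := by
  set I : Ideal K⟦X⟧ := Ideal.span {(PowerSeries.X : K⟦X⟧)}
  let : TopologicalSpace K⟦X⟧ := I.adic_basis.topology
  set B := (I.ringFilterBasis.moduleFilterBasis (I.adic_module_basis M)) with hB
  have h := B.toAddGroupFilterBasis.nhds_hasBasis x
  have hmem : ∀ m : ℕ, ∀ z : M, z ∈ (I ^ m • (⊤ : Submodule K⟦X⟧ M)) ↔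
      ∃ w : M, z = (PowerSeries.X : K⟦X⟧) ^ m • w := by
    intro m z
    rw [Ideal.span_singleton_pow, Submodule.ideal_span_singleton_smul]
    rw [Submodule.mem_smul_pointwise_iff_exists]
    constructor
    · rintro ⟨w, -, rfl⟩; exact ⟨w, rfl⟩
    · rintro ⟨w, rfl⟩; exact ⟨w, trivial, rfl⟩
  refine ⟨fun U => ?_⟩
  have h1 := h.mem_iff (t := U)
  refine Iff.trans h1 ⟨?_, ?_⟩
  · rintro ⟨V, ⟨m, rfl⟩, hV⟩
    refine ⟨m, trivial, ?_⟩
    rintro y ⟨z, hz⟩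
    refine hV ⟨y - x, ?_, by simp⟩
    exact (hmem m _).2 ⟨z, hz⟩
  · rintro ⟨m, -, hm⟩
    refine ⟨_, ⟨m, rfl⟩, ?_⟩
    rintro _ ⟨z, hz, rfl⟩
    obtain ⟨w, rfl⟩ := (hmem m z).1 hz
    exact hm ⟨w, by simp⟩

theorem hasHSum_iff {f : ℕ → M} {s : M} :
    HasHSum K f s ↔ ∀ m : ℕ, ∃ N₀ : ℕ, ∀ N ≥ N₀, ∃ z : M,
      ∑ a ∈ Finset.range N, f a - s = (PowerSeries.X : K⟦X⟧) ^ m • z := by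
  rw [HasHSum, (hTopology_hasBasis s).tendsto_right_iff]
  simp [eventually_atTop]

theorem mem_hClosure_iff {S : Set M} {x : M} :
    x ∈ @closure M (hTopology K M) S ↔
      ∀ m : ℕ, ∃ y ∈ S, ∃ z : M, y - x = (PowerSeries.X : K⟦X⟧) ^ m • z := by
  let := hTopology K M
  rw [mem_closure_iff_nhds_basis (hTopology_hasBasis x)]
  simp

theorem HasHSum.map {M' : Type*} [AddCommGroup M'] [Module K⟦X⟧ M'] (φ : M →ₗ[K⟦X⟧] M')
    {f : ℕ → M} {s : M} (hf : HasHSum K f s) : HasHSum K (fun a => φ (f a)) (φ s) := by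
  rw [hasHSum_iff] at hf ⊢
  intro m
  obtain ⟨N₀, hN⟩ := hf m
  refine ⟨N₀, fun N h => ?_⟩
  obtain ⟨z, hz⟩ := hN N h
  exact ⟨φ z, by rw [← map_sum, ← map_sub, hz, map_smul]⟩

end Topology

/-! ### Divisibility by powers of `h` in `A⟦h⟧` -/

section Series

variable {K : Type*} [Field K] {A : Type*} [Ring A] [Algebra K A]

theorem hAlgebra_smul_def (c : K⟦X⟧) (x : A⟦X⟧) :
    letI := hAlgebra K A
    c • x = PowerSeries.map (algebraMap K A) c * x := rfl

theorem X_pow_hsmul (m : ℕ) (x : A⟦X⟧) :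
    letI := hAlgebra K A
    (PowerSeries.X : K⟦X⟧) ^ m • x = PowerSeries.X ^ m * x := by
  simp [hAlgebra_smul_def]

theorem exists_X_pow_mul_iff (m : ℕ) (x : A⟦X⟧) :
    (∃ z, x = PowerSeries.X ^ m * z) ↔ ∀ i < m, PowerSeries.coeff i x = 0 :=
  PowerSeries.X_pow_dvd_iff

theorem hasHSum_series_iff {f : ℕ → A⟦X⟧} {s : A⟦X⟧} :
    letI := hAlgebra K A
    HasHSum K f s ↔ ∀ m : ℕ, ∃ N₀ : ℕ, ∀ N ≥ N₀, ∀ i < m,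
      PowerSeries.coeff i (∑ a ∈ Finset.range N, f a) = PowerSeries.coeff i s := by
  let := hAlgebra K A
  rw [hasHSum_iff]
  simp only [X_pow_hsmul, exists_X_pow_mul_iff, map_sub, sub_eq_zero]

/-- A sequence of formal series tending to zero has a sum. -/
theorem exists_hasHSum (f : ℕ → A⟦X⟧)
    (hf : ∀ i : ℕ, ∃ N : ℕ, ∀ a ≥ N, PowerSeries.coeff i (f a) = 0) :
    letI := hAlgebra K A
    ∃ s, HasHSum K f s := by
  let := hAlgebra K A
  choose N hN using hf
  refine ⟨PowerSeries.mk fun i => ∑ a ∈ Finset.range (N i), PowerSeries.coeff i (f a), ?_⟩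
  rw [hasHSum_series_iff]
  intro m
  refine ⟨(Finset.range m).sup N, fun n hn i hi => ?_⟩
  rw [map_sum, PowerSeries.coeff_mk]
  have : N i ≤ n := (Finset.le_sup (Finset.mem_range.2 hi)).trans hn
  exact (Finset.sum_subset (by simpa using this) fun a _ ha => hN i a (by simpa using ha)).symm

end Series

theorem hasHSum_field_series_iff {K : Type*} [Field K] {f : ℕ → K⟦X⟧} {s : K⟦X⟧} :
    HasHSum K f s ↔ ∀ m : ℕ, ∃ N₀ : ℕ, ∀ N ≥ N₀, ∀ i < m,
      PowerSeries.coeff i (∑ a ∈ Finset.range N, f a) = PowerSeries.coeff i s := by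
  rw [hasHSum_iff]
  simp only [smul_eq_mul, exists_X_pow_mul_iff, map_sub, sub_eq_zero]

/-! ### Polynomial interpolation -/

section Interpolation

variable {K : Type*} [Field K]

/-- The value at `x ∈ K` of an element of `K[T]⟦h⟧`. -/
abbrev evalAt (x : K) : K[X]⟦X⟧ →+* K⟦X⟧ := PowerSeries.map (Polynomial.evalRingHom x)

theorem coeff_evalAt (x : K) (p : K[X]⟦X⟧) (m : ℕ) :
    PowerSeries.coeff m (evalAt x p) = (PowerSeries.coeff m p).eval x := by
  simp [evalAt]

/-- A half-line suffices because it is infinite in characteristic zero. The uniqueness and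
faithfulness arguments control values only there, where the products of ψ^b(n) are known not to
vanish. -/
theorem polynomial_eq_of_eval_int_lt [CharZero K] {p q : K[X]} (N : ℤ)
    (h : ∀ n : ℤ, n < N → p.eval (n : K) = q.eval (n : K)) : p = q := by
  refine Polynomial.eq_of_infinite_eval_eq p q ?_
  refine Set.Infinite.mono (s := (fun n : ℤ => (n : K)) '' Set.Iio N) ?_ ?_
  · rintro _ ⟨n, hn, rfl⟩
    exact h n hn
  · exact (Set.Iio_infinite N).image (Int.cast_injective.injOn)

theorem eq_of_evalAt_int_lt [CharZero K] {p q : K[X]⟦X⟧} (N : ℤ)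
    (h : ∀ n : ℤ, n < N → evalAt (n : K) p = evalAt (n : K) q) : p = q := by
  ext1 m
  refine polynomial_eq_of_eval_int_lt N fun n hn => ?_
  rw [← coeff_evalAt, ← coeff_evalAt, h n hn]

/-- Uniformly in `k`, the coefficient of each power of `h` has bounded degree. -/
def UniformlyBounded (F : ℕ → K[X]⟦X⟧) : Prop :=
  ∀ m : ℕ, ∃ D : ℕ, ∀ k : ℕ, (PowerSeries.coeff m (F k)).natDegree ≤ D

theorem UniformlyBounded.mul {F G : ℕ → K[X]⟦X⟧} (hF : UniformlyBounded F)
    (hG : UniformlyBounded G) : UniformlyBounded fun k => F k * G k := by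
  intro m
  choose D hD using hF
  choose D' hD' using hG
  refine ⟨(antidiagonal m).sup fun p => D p.1 + D' p.2, fun k => ?_⟩
  rw [PowerSeries.coeff_mul]
  refine Polynomial.natDegree_sum_le_of_forall_le _ _ fun p hp => ?_
  refine Polynomial.natDegree_mul_le.trans ((add_le_add (hD _ _) (hD' _ _)).trans ?_)
  exact Finset.le_sup (f := fun p : ℕ × ℕ => D p.1 + D' p.2) hp

theorem UniformlyBounded.prod {ι : Type*} (s : Finset ι) {F : ι → ℕ → K[X]⟦X⟧}
    (hF : ∀ i ∈ s, UniformlyBounded (F i)) : UniformlyBounded fun k => ∏ i ∈ s, F i k := by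
  classical
  induction s using Finset.induction_on with
  | empty =>
    refine fun m => ⟨0, fun k => ?_⟩
    simp only [Finset.prod_empty, PowerSeries.coeff_one]
    split_ifs <;> simp
  | insert i s hi ih =>
    simp only [Finset.prod_insert hi]
    exact (hF i (Finset.mem_insert_self _ _)).mul
      (ih fun j hj => hF j (Finset.mem_insert_of_mem hj))

/-- At order h^m, summability of g kills all terms a ≥ N m, leaving a polynomial in n. As N m does
not depend on k, it bounds the degrees uniformly. -/
theorem IsRegularSeq.exists_interpolation {d : ℕ} {f : ℕ → ℤ → K⟦X⟧} (hf : IsRegularSeq d f) :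
    ∃ P : ℕ → K[X]⟦X⟧, UniformlyBounded P ∧
      ∀ k ≥ d, ∀ n : ℤ, evalAt (n : K) (P k) = f k n := by
  obtain ⟨g, hg, hfg⟩ := hf
  have hg' : ∀ m : ℕ, ∃ N : ℕ, ∀ a ≥ N, ∀ k : ℤ, PowerSeries.coeff m (g a k) = 0 := by
    intro m
    obtain ⟨N, hN⟩ := hg (m + 1)
    exact ⟨N, fun a ha k => PowerSeries.X_pow_dvd_iff.1 (hN a ha k) m (Nat.lt_succ_self m)⟩
  choose N hN using hg'
  refine ⟨fun k => PowerSeries.mk fun m => ∑ a ∈ Finset.range (N m),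
    Polynomial.C (PowerSeries.coeff m (g a k)) * Polynomial.X ^ a, ?_, ?_⟩
  · intro m
    refine ⟨N m, fun k => ?_⟩
    rw [PowerSeries.coeff_mk]
    refine Polynomial.natDegree_sum_le_of_forall_le _ _ fun a ha => ?_
    exact (Polynomial.natDegree_C_mul_X_pow_le _ _).trans (Finset.mem_range.1 ha).le
  · intro k hk n
    ext m
    rw [coeff_evalAt, PowerSeries.coeff_mk, Polynomial.eval_finsetSum]
    obtain ⟨N₀, hN₀⟩ := hasHSum_field_series_iff.1 (hfg k hk n) (m + 1)
    rw [← hN₀ (max N₀ (N m)) (le_max_left _ _) m (Nat.lt_succ_self m), map_sum]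
    have hcoeff : ∀ a, PowerSeries.coeff m (g a k * (n : K⟦X⟧) ^ a)
        = PowerSeries.coeff m (g a k) * (n : K) ^ a := by
      intro a
      rw [← map_intCast (PowerSeries.C : K →+* K⟦X⟧) n, ← map_pow, PowerSeries.coeff_mul_C]
    simp only [hcoeff, Polynomial.eval_mul, Polynomial.eval_C, Polynomial.eval_pow,
      Polynomial.eval_X]
    refine Finset.sum_subset (by simp) fun a _ ha => ?_
    rw [hN m a (by simpa using ha), zero_mul]

/-- A sequence interpolated by `p` whose coefficients in each degree in `h` are finitely supported
is summable. -/
theorem isSummableSeq_of_interpolates {p : ℕ → K[X]⟦X⟧} {ξ : ℕ → ℤ → K⟦X⟧}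
    (hpξ : Interpolates p ξ)
    (hp : ∀ m : ℕ, ∃ N : ℕ, ∀ a ≥ N, PowerSeries.coeff m (p a) = 0) : IsSummableSeq ξ := by
  choose N hN using hp
  intro m
  refine ⟨(Finset.range m).sup N, fun a ha n => PowerSeries.X_pow_dvd_iff.2 fun i hi => ?_⟩
  rw [← hpξ a n]
  change PowerSeries.coeff i (evalAt (n : K) (p a)) = 0
  rw [coeff_evalAt, hN i a ((Finset.le_sup (Finset.mem_range.2 hi)).trans ha),
    Polynomial.eval_zero]

theorem isRegularSeq_of_interpolates {p : ℕ → K[X]⟦X⟧} {ξ : ℕ → ℤ → K⟦X⟧}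
    (hpξ : Interpolates p ξ) (hp : UniformlyBounded p) : IsRegularSeq 0 ξ := by
  choose D hD using hp
  have hzero : ∀ m a k, D m < a → (PowerSeries.coeff m (p k)).coeff a = 0 := fun m a k h =>
    Polynomial.coeff_eq_zero_of_natDegree_lt ((hD m k).trans_lt h)
  -- Only k ≥ 0 matters; `toNat` supplies values at negative k that obey the same degree bound, so
  -- that g is summable on all of ℤ.
  refine ⟨fun a k => PowerSeries.mk fun m => (PowerSeries.coeff m (p k.toNat)).coeff a, ?_, ?_⟩
  · intro m
    refine ⟨(Finset.range m).sup D + 1, fun a ha k => PowerSeries.X_pow_dvd_iff.2 fun i hi => ?_⟩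
    rw [PowerSeries.coeff_mk]
    refine hzero _ _ _ ?_
    have := Finset.le_sup (f := D) (Finset.mem_range.2 hi)
    omega
  · intro k _ n
    rw [hasHSum_field_series_iff]
    intro m
    refine ⟨(Finset.range m).sup D + 1, fun N hN i hi => ?_⟩
    have hi' := Finset.le_sup (f := D) (Finset.mem_range.2 hi)
    rw [← hpξ k n]
    change _ = PowerSeries.coeff i (evalAt (n : K) (p k))
    rw [coeff_evalAt, Polynomial.eval_eq_sum_range' (n := N) (by have := hD i k; omega), map_sum]
    refine Finset.sum_congr rfl fun a _ => ?_
    rw [← map_intCast (PowerSeries.C : K →+* K⟦X⟧) n, ← map_pow, PowerSeries.coeff_mul_C,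
      PowerSeries.coeff_mk, Int.toNat_natCast]

end Interpolation

/-! ### Newton expansion of symmetric sequences of polynomials -/

section Newton

variable {K : Type*} [Field K]

/-- The polynomial `∏_{j < a} (k - j) (N + k + j + 1)` in the variable `N`. -/
def newtonBasis (K : Type*) [Field K] (a k : ℕ) : K[X] :=
  ∏ j ∈ Finset.range a, Polynomial.C ((k - j : ℕ) : K) *
    (Polynomial.X + Polynomial.C ((k : K) + j + 1))

theorem newtonBasis_eq_zero {a k : ℕ} (h : k < a) : newtonBasis K a k = 0 :=
  Finset.prod_eq_zero (Finset.mem_range.2 h) (by simp)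

theorem newtonBasis_zero (k : ℕ) : newtonBasis K 0 k = 1 := by simp [newtonBasis]

/-- The factor j = 0 is split off; in the others the shifts of k and j leave k - j unchanged and add
2 to N + k + j + 1. -/
theorem newtonBasis_succ_succ (a k : ℕ) :
    newtonBasis K (a + 1) (k + 1) =
      Polynomial.C ((k : K) + 1) * (Polynomial.X + Polynomial.C ((k : K) + 2)) *
        (newtonBasis K a k).comp (Polynomial.X + Polynomial.C 2) := by
  rw [newtonBasis, Finset.prod_range_succ', mul_comm, newtonBasis, Polynomial.prod_comp]
  congr 1
  · simp only [Nat.sub_zero]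
    push_cast
    congr 3
    ring
  · refine Finset.prod_congr rfl fun j _ => ?_
    rw [Nat.add_sub_add_right]
    simp only [Polynomial.mul_comp, Polynomial.C_comp, Polynomial.add_comp, Polynomial.X_comp]
    rw [add_assoc Polynomial.X, ← Polynomial.C_add]
    congr 3
    push_cast
    ring

/-- Every sequence of polynomials of bounded degree with `G_k(-j-k-1) = G_j(-j-k-1)` has a finite
expansion in the polynomials `newtonBasis K a k`. -/
theorem exists_newton_expansion [CharZero K] (D : ℕ) (G : ℕ → K[X])
    (hD : ∀ k, (G k).degree < D)
    (hG : ∀ j k : ℕ, (G k).eval (-(j : K) - k - 1) = (G j).eval (-(j : K) - k - 1)) :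
    ∃ c : ℕ → K[X], (∀ a ≥ D, c a = 0) ∧
      ∀ k, ∑ a ∈ Finset.range D, newtonBasis K a k * c a = G k := by
  -- Newton's divided differences: by the symmetry at j = 0, G (k+1) - G 0 vanishes at N = -(k+2),
  -- hence is divisible by the first Newton factor (k+1)(N+k+2). The quotients, translated by N ↦ N
  -- - 2 to fit `newtonBasis_succ_succ`, form a symmetric sequence whose degree bound is one lower.
  induction D generalizing G with
  | zero =>
    refine ⟨fun _ => 0, fun _ _ => rfl, fun k => ?_⟩
    have := hD k
    simp only [Nat.cast_zero] at this
    rw [Finset.range_zero, Finset.sum_empty]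
    exact (Polynomial.degree_eq_bot.1 (by
      by_contra h
      exact absurd this (not_lt.2 (Polynomial.zero_le_degree_iff.2 fun h0 => h (by simp [h0]))))).symm
  | succ D ih =>
    have hdvd : ∀ k : ℕ, ∃ Q : K[X], G (k + 1) - G 0 =
        (Polynomial.C ((k : K) + 1) * (Polynomial.X + Polynomial.C ((k : K) + 2))) * Q := by
      intro k
      have hroot : (G (k + 1) - G 0).IsRoot (-((k : K) + 2)) := by
        have := hG 0 (k + 1)
        push_cast at this
        rw [show -(0 : K) - (k + 1) - 1 = -((k : K) + 2) by ring] at this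
        rw [Polynomial.IsRoot.def, Polynomial.eval_sub, this, sub_self]
      obtain ⟨Q, hQ⟩ := Polynomial.dvd_iff_isRoot.2 hroot
      have hk : ((k : K) + 1) ≠ 0 := Nat.cast_add_one_ne_zero k
      refine ⟨Polynomial.C ((k : K) + 1)⁻¹ * Q, ?_⟩
      rw [hQ, Polynomial.C_neg, sub_neg_eq_add]
      calc _ = (Polynomial.C ((k : K) + 1) * Polynomial.C ((k : K) + 1)⁻¹) *
            ((Polynomial.X + Polynomial.C ((k : K) + 2)) * Q) := by
              rw [← Polynomial.C_mul, mul_inv_cancel₀ hk, Polynomial.C_1, one_mul]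
        _ = _ := by ring
    choose Q hQ using hdvd
    have hQeval : ∀ (k : ℕ) (x : K), (G (k + 1)).eval x - (G 0).eval x =
        ((k : K) + 1) * (x + (k + 2)) * (Q k).eval x := by
      intro k x
      have := congrArg (Polynomial.eval x) (hQ k)
      simpa using this
    obtain ⟨c, hc0, hc⟩ := ih (fun k => (Q k).comp (Polynomial.X - Polynomial.C 2)) (by
      intro k
      have hk : ((k : K) + 1) ≠ 0 := Nat.cast_add_one_ne_zero k
      have h1 : (G (k + 1) - G 0).degree < ((D + 1 : ℕ) : WithBot ℕ) :=
        (Polynomial.degree_sub_le _ _).trans_lt (max_lt (hD _) (hD _))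
      rw [hQ, mul_assoc, Polynomial.degree_C_mul hk, Polynomial.degree_mul,
        Polynomial.degree_X_add_C] at h1
      rw [Polynomial.degree_lt_iff_coeff_zero]
      intro m hm
      have hdeg : ((Q k).comp (Polynomial.X - Polynomial.C 2)).natDegree = (Q k).natDegree := by
        rw [Polynomial.natDegree_comp, Polynomial.natDegree_X_sub_C, mul_one]
      by_cases hq : Q k = 0
      · simp [hq]
      refine Polynomial.coeff_eq_zero_of_natDegree_lt ?_
      rw [hdeg]
      rw [Polynomial.degree_eq_natDegree hq] at h1
      have : 1 + (Q k).natDegree < D + 1 := by exact_mod_cast h1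
      omega) (by
      intro j k
      simp only [Polynomial.eval_comp, Polynomial.eval_sub, Polynomial.eval_X, Polynomial.eval_C]
      set x : K := -(j : K) - k - 1 - 2 with hx
      have h1 := hQeval k x
      have h2 := hQeval j x
      have h3 := hG (j + 1) (k + 1)
      rw [show -((j + 1 : ℕ) : K) - ((k + 1 : ℕ) : K) - 1 = x by push_cast; ring] at h3
      rw [h3, h2] at h1
      have hk : ((k : K) + 1) ≠ 0 := Nat.cast_add_one_ne_zero k
      have hj : ((j : K) + 1) ≠ 0 := Nat.cast_add_one_ne_zero j
      -- At this point the divisors for k and for j both equal -(j+1)(k+1), so cancelling them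
      -- carries the symmetry over to the quotients.
      have e1 : x + (j + 2) = -((k : K) + 1) := by rw [hx]; ring
      have e2 : x + (k + 2) = -((j : K) + 1) := by rw [hx]; ring
      rw [e1, e2] at h1
      have : ((j : K) + 1) * ((k : K) + 1) ≠ 0 := mul_ne_zero hj hk
      refine mul_left_cancel₀ this ?_
      linear_combination h1)
    refine ⟨fun a => if a = 0 then G 0 else (c (a - 1)).comp (Polynomial.X + Polynomial.C 2),
      ?_, ?_⟩
    · intro a ha
      have : a ≠ 0 := by omega
      simp only [if_neg this]
      rw [hc0 _ (by omega), Polynomial.zero_comp]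
    · intro k
      rw [Finset.sum_range_succ']
      simp only [if_true, Nat.add_eq_zero_iff, one_ne_zero, and_false, if_false,
        Nat.add_sub_cancel, newtonBasis_zero, one_mul]
      rcases k with _ | k
      · rw [Finset.sum_eq_zero fun a _ => ?_, zero_add]
        rw [newtonBasis_eq_zero (Nat.succ_pos a), zero_mul]
      · have := congrArg (fun q => q.comp (Polynomial.X + Polynomial.C (2 : K))) (hc k)
        simp only [Polynomial.comp_assoc, Polynomial.sub_comp, Polynomial.X_comp,
          Polynomial.C_comp, add_sub_cancel_right, Polynomial.comp_X, Polynomial.sum_comp,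
          Polynomial.mul_comp] at this
        simp only [newtonBasis_succ_succ, mul_assoc _ (Polynomial.comp _ _), ← Finset.mul_sum]
        rw [this, ← hQ]
        ring

/-- The symmetric sequences of polynomials of bounded degree. -/
def symmetricSeq (K : Type*) [Field K] : AddSubgroup (ℕ → K[X]) where
  carrier := {G | (∃ D : ℕ, ∀ k, (G k).natDegree ≤ D) ∧
    ∀ j k : ℕ, (G k).eval (-(j : K) - k - 1) = (G j).eval (-(j : K) - k - 1)}
  zero_mem' := ⟨⟨0, fun k => by simp⟩, fun j k => by simp⟩
  add_mem' := by
    rintro F G ⟨⟨D, hD⟩, hF⟩ ⟨⟨D', hD'⟩, hG⟩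
    refine ⟨⟨max D D', fun k => ?_⟩, fun j k => ?_⟩
    · exact (Polynomial.natDegree_add_le _ _).trans (max_le_max (hD k) (hD' k))
    · simp [hF, hG]
  neg_mem' := by
    rintro F ⟨⟨D, hD⟩, hF⟩
    exact ⟨⟨D, fun k => by simpa using hD k⟩, fun j k => by simp [hF]⟩

theorem exists_newton_expansion_of_mem [CharZero K] {G : ℕ → K[X]} (hG : G ∈ symmetricSeq K) :
    ∃ c : ℕ →₀ K[X], (fun k => c.sum fun a q => newtonBasis K a k * q) = G := by
  obtain ⟨⟨D, hD⟩, hG⟩ := hG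
  obtain ⟨c, hc0, hc⟩ := exists_newton_expansion (D + 1) G (fun k =>
    Polynomial.degree_le_natDegree.trans_lt (by exact_mod_cast Nat.lt_succ_of_le (hD k))) hG
  refine ⟨Finsupp.onFinset (Finset.range (D + 1)) c fun a ha => ?_, ?_⟩
  · by_contra h
    exact ha (hc0 a (by simpa using h))
  · funext k
    rw [Finsupp.onFinset_sum _ (fun a => mul_zero _), hc k]

end Newton

/-- Solving a linear equation order by order in `h`. -/
theorem exists_series_solution {M T : Type*} [AddCommGroup T] (L : ℕ → M → T) (S : AddSubgroup T)
    (hL : ∀ i c, L i c ∈ S) (h0 : ∀ t ∈ S, ∃ c, L 0 c = t) (t : ℕ → T) (ht : ∀ m, t m ∈ S)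
    (x₀ : M) (hx₀ : L 0 x₀ = t 0) :
    ∃ x : ℕ → M, x 0 = x₀ ∧ ∀ m, ∑ p ∈ antidiagonal m, L p.1 (x p.2) = t m := by
  classical
  have : Nonempty M := ⟨x₀⟩
  -- With membership in S moved inside the statement, the chosen preimage is a total function,
  -- usable in the recursion before membership is proved.
  have h0' : ∀ t : T, ∃ c, t ∈ S → L 0 c = t := fun t => by
    by_cases h : t ∈ S
    · obtain ⟨c, hc⟩ := h0 t h
      exact ⟨c, fun _ => hc⟩
    · exact ⟨x₀, fun h' => absurd h' h⟩
  choose g hg using h0'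
  -- The equation at order m is L 0 (x m) = t m - ∑_{i ≥ 1} L i (x (m - i)). The value at order 0 is
  -- prescribed rather than chosen, so that the solution is known modulo h.
  let step : (m : ℕ) → ((j : ℕ) → j < m → M) → M := fun m ih =>
    if m = 0 then x₀ else
      g (t m - ∑ i : Fin m, L (i + 1) (ih (m - (i + 1)) (by omega)))
  let x : ℕ → M := fun m => Nat.strongRec step m
  have hx : ∀ m, x m = step m fun j _ => x j := fun m => by
    simp only [x]
    rw [Nat.strongRec]
  refine ⟨x, by rw [hx]; simp [step], fun m => ?_⟩
  rcases Nat.eq_zero_or_pos m with rfl | hm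
  · have : x 0 = x₀ := by rw [hx]; simp [step]
    simp [this, hx₀]
  · have h1 : L 0 (x m) = t m - ∑ i : Fin m, L (i + 1) (x (m - (i + 1))) := by
      rw [hx m]
      simp only [step, if_neg hm.ne']
      exact hg _ (S.sub_mem (ht m) (S.sum_mem fun i _ => hL _ _))
    rw [Finset.Nat.sum_antidiagonal_eq_sum_range_succ (fun i j => L i (x j)),
      Finset.sum_range_succ', Nat.sub_zero, h1,
      Finset.sum_range (fun i => L (i + 1) (x (m - (i + 1))))]
    abel

/-! ### Solving the equation `ψ ⋉ ξ = ψ[+1]` -/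

section Equation

variable {K : Type*} [Field K]

/-- The substitution `T ↦ T + 2k` in `K[T]⟦h⟧`. -/
def weightShift (K : Type*) [Field K] (k : ℕ) : K[X]⟦X⟧ →+* K[X]⟦X⟧ :=
  PowerSeries.map (Polynomial.compRingHom (Polynomial.X + Polynomial.C (2 * (k : K))))

theorem coeff_weightShift (k m : ℕ) (p : K[X]⟦X⟧) :
    PowerSeries.coeff m (weightShift K k p) =
      (PowerSeries.coeff m p).comp (Polynomial.X + Polynomial.C (2 * (k : K))) := by
  simp [weightShift]

theorem evalAt_weightShift (x : K) (k : ℕ) (p : K[X]⟦X⟧) :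
    evalAt x (weightShift K k p) = evalAt (x + 2 * k) p := by
  ext m
  rw [coeff_evalAt, coeff_weightShift, coeff_evalAt]
  simp

/-- `Ψ^k ∈ K[T]⟦h⟧` interpolates `ψ^k` for `k ≥ 1`, with `Ψ^0 = 0` and with degrees bounded
uniformly in `k`. -/
structure IsInterpolation (ψ : Colouring K) (Ψ : ℕ → K[X]⟦X⟧) : Prop where
  zero : Ψ 0 = 0
  evalAt : ∀ k ≥ 1, ∀ n : ℤ, evalAt (n : K) (Ψ k) = ψ.toFun k n
  bounded : UniformlyBounded Ψ

theorem Colouring.exists_isInterpolation (ψ : Colouring K) (hψ : IsRegularSeq 1 ψ.toFun) :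
    ∃ Ψ, IsInterpolation ψ Ψ := by
  obtain ⟨P, hP, hPψ⟩ := hψ.exists_interpolation
  refine ⟨fun k => if k = 0 then 0 else P k, by simp, fun k hk n => ?_, fun m => ?_⟩
  · have : k ≠ 0 := by omega
    simp only [this, if_false]
    exact hPψ k hk n
  · obtain ⟨D, hD⟩ := hP m
    refine ⟨D, fun k => ?_⟩
    split_ifs
    · simp
    · exact hD k

/-- `∏_{j < a} Ψ^{k-j}(N + 2k)`, in the variable `N`. -/
def shiftedProd (Ψ : ℕ → K[X]⟦X⟧) (a k : ℕ) : K[X]⟦X⟧ :=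
  ∏ j ∈ Finset.range a, weightShift K k (Ψ (k - j))

namespace IsInterpolation

variable {ψ : Colouring K} {Ψ : ℕ → K[X]⟦X⟧}

/-- The convention Ψ 0 = 0 turns `c2` into the case k = 0 of `c3`. -/
theorem reflect (h : IsInterpolation ψ Ψ) (n k : ℕ) :
    ColouredKM.evalAt (n : K) (Ψ (n + k + 1)) = ColouredKM.evalAt (-(n : K) - 2) (Ψ k) := by
  have h1 := h.evalAt (n + k + 1) (by omega) n
  rw [Int.cast_natCast] at h1
  rw [h1]
  rcases Nat.eq_zero_or_pos k with rfl | hk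
  · rw [h.zero, map_zero]
    exact ψ.c2 n
  · rw [ψ.c3 k hk n, ← h.evalAt k hk]
    push_cast
    rfl

theorem shiftedProd_eq_zero (h : IsInterpolation ψ Ψ) {a k : ℕ} (hak : k < a) :
    shiftedProd Ψ a k = 0 :=
  Finset.prod_eq_zero (Finset.mem_range.2 hak) (by rw [Nat.sub_self, h.zero, map_zero])

theorem evalAt_shiftedProd (h : IsInterpolation ψ Ψ) {a k : ℕ} (hak : a ≤ k) (n : ℤ) :
    ColouredKM.evalAt ((n - 2 * k : ℤ) : K) (shiftedProd Ψ a k) =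
      ∏ b ∈ Finset.Icc (k - a + 1) k, ψ.toFun b n := by
  rw [shiftedProd, map_prod]
  refine Finset.prod_bij' (fun j _ => k - j) (fun b _ => k - b) ?_ ?_ ?_ ?_ ?_
  · intro j hj
    simp only [Finset.mem_range, Finset.mem_Icc] at hj ⊢
    omega
  · intro j hj
    simp only [Finset.mem_range, Finset.mem_Icc] at hj ⊢
    omega
  · intro j hj
    simp only [Finset.mem_range] at hj
    omega
  · intro j hj
    simp only [Finset.mem_Icc] at hj
    omega
  · intro j hj
    simp only [Finset.mem_range] at hj
    rw [evalAt_weightShift, ← h.evalAt _ (by omega)]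
    congr 2
    push_cast
    ring

/-- For k = j + n + 1 and N = -j-k-1 one has N + 2k = n and N + 2j = -n-2, so `reflect` matches the
factors i ≤ j one by one. If a > j, both products contain the factor i = j, which is zero. -/
theorem evalAt_shiftedProd_symm (h : IsInterpolation ψ Ψ) (a j k : ℕ) :
    ColouredKM.evalAt (-(j : K) - k - 1) (shiftedProd Ψ a k) =
      ColouredKM.evalAt (-(j : K) - k - 1) (shiftedProd Ψ a j) := by
  wlog hjk : j < k generalizing j k
  · rcases (not_lt.1 hjk).eq_or_lt with rfl | hlt
    · rfl
    · have := this k j hlt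
      rw [show -(k : K) - j - 1 = -(j : K) - k - 1 by ring] at this
      exact this.symm
  obtain ⟨n, rfl⟩ := Nat.exists_eq_add_of_lt hjk
  have e1 : -(j : K) - ((j + n + 1 : ℕ) : K) - 1 + 2 * ((j + n + 1 : ℕ) : K) = n := by
    push_cast; ring
  have e2 : -(j : K) - ((j + n + 1 : ℕ) : K) - 1 + 2 * (j : K) = -(n : K) - 2 := by
    push_cast; ring
  simp only [shiftedProd, map_prod, evalAt_weightShift, e1, e2]
  have key : ∀ i ≤ j, ColouredKM.evalAt (n : K) (Ψ (j + n + 1 - i)) =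
      ColouredKM.evalAt (-(n : K) - 2) (Ψ (j - i)) := by
    intro i hi
    rw [← h.reflect n (j - i)]
    congr 2
    omega
  by_cases ha : a ≤ j
  · exact Finset.prod_congr rfl fun i hi => key i (by have := Finset.mem_range.1 hi; omega)
  · have hz : ColouredKM.evalAt (-(n : K) - 2) (Ψ (j - j)) = 0 := by
      rw [Nat.sub_self, h.zero, map_zero]
    have hj : j ∈ Finset.range a := by simpa using ha
    rw [Finset.prod_eq_zero hj ((key j le_rfl).trans hz), Finset.prod_eq_zero hj hz]

theorem coeff_zero [CharZero K] (h : IsInterpolation ψ Ψ) (k : ℕ) :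
    PowerSeries.coeff 0 (Ψ k) =
      Polynomial.C (k : K) * (Polynomial.X - Polynomial.C (k : K) + 1) := by
  rcases Nat.eq_zero_or_pos k with rfl | hk
  · simp [h.zero]
  · refine polynomial_eq_of_eval_int_lt 0 fun n _ => ?_
    rw [← coeff_evalAt, h.evalAt k hk, PowerSeries.coeff_zero_eq_constantCoeff_apply, ψ.c1 k hk]
    simp

/-- Replacing k by k - j and n by N + 2k in k(n-k+1) gives (k-j)(N+k+j+1). -/
theorem coeff_zero_shiftedProd [CharZero K] (h : IsInterpolation ψ Ψ) (a k : ℕ) :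
    PowerSeries.coeff 0 (shiftedProd Ψ a k) = newtonBasis K a k := by
  rcases lt_or_ge k a with hak | hak
  · rw [h.shiftedProd_eq_zero hak, newtonBasis_eq_zero hak, map_zero]
  · rw [PowerSeries.coeff_zero_eq_constantCoeff_apply, shiftedProd, map_prod, newtonBasis]
    refine Finset.prod_congr rfl fun j hj => ?_
    have hj := Finset.mem_range.1 hj
    rw [← PowerSeries.coeff_zero_eq_constantCoeff_apply, coeff_weightShift, h.coeff_zero,
      Nat.cast_sub (by omega)]
    simp only [Polynomial.mul_comp, Polynomial.C_comp, Polynomial.add_comp, Polynomial.sub_comp,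
      Polynomial.X_comp, Polynomial.one_comp, map_sub, map_add, map_mul, map_one, map_ofNat]
    ring

theorem uniformlyBounded_weightShift {F : ℕ → K[X]⟦X⟧} (hF : UniformlyBounded F) (s : ℕ → ℕ) :
    UniformlyBounded fun k => weightShift K k (F (s k)) := by
  intro m
  obtain ⟨D, hD⟩ := hF m
  refine ⟨D, fun k => ?_⟩
  rw [coeff_weightShift, Polynomial.natDegree_comp, Polynomial.natDegree_X_add_C, mul_one]
  exact hD _

theorem uniformlyBounded_shiftedProd (h : IsInterpolation ψ Ψ) (a : ℕ) :
    UniformlyBounded (shiftedProd Ψ a) :=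
  UniformlyBounded.prod _ fun j _ => uniformlyBounded_weightShift h.bounded fun k => k - j

theorem coeff_shiftedProd_mul_mem (h : IsInterpolation ψ Ψ) (i a : ℕ) (q : K[X]) :
    (fun k => PowerSeries.coeff i (shiftedProd Ψ a k) * q) ∈ symmetricSeq K := by
  refine ⟨?_, fun j k => ?_⟩
  · obtain ⟨D, hD⟩ := h.uniformlyBounded_shiftedProd a i
    exact ⟨D + q.natDegree, fun k =>
      Polynomial.natDegree_mul_le.trans (Nat.add_le_add_right (hD k) _)⟩
  · rw [Polynomial.eval_mul, Polynomial.eval_mul, ← coeff_evalAt, ← coeff_evalAt,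
      h.evalAt_shiftedProd_symm]

theorem coeff_weightShift_succ_mem (h : IsInterpolation ψ Ψ) (i : ℕ) :
    (fun k => PowerSeries.coeff i (weightShift K k (Ψ (k + 1)))) ∈ symmetricSeq K := by
  refine ⟨uniformlyBounded_weightShift h.bounded (fun k => k + 1) i, fun j k => ?_⟩
  rw [← coeff_evalAt, ← coeff_evalAt, evalAt_weightShift, evalAt_weightShift]
  congr 1
  wlog hjk : j < k generalizing j k
  · rcases (not_lt.1 hjk).eq_or_lt with rfl | hlt
    · rfl
    · have := this k j hlt
      rw [show -(k : K) - j - 1 = -(j : K) - k - 1 by ring] at this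
      exact this.symm
  obtain ⟨n, rfl⟩ := Nat.exists_eq_add_of_lt hjk
  have e1 : -(j : K) - ((j + n + 1 : ℕ) : K) - 1 + 2 * ((j + n + 1 : ℕ) : K) = n := by
    push_cast; ring
  have e2 : -(j : K) - ((j + n + 1 : ℕ) : K) - 1 + 2 * (j : K) = -(n : K) - 2 := by
    push_cast; ring
  rw [e1, e2, ← h.reflect]
  congr 2
  omega

/-- The interpolated form of the equation `ψ ⋉ ξ = ψ[+1]` has a solution, equal to
`(T, 1, 0, 0, …)` modulo `h`. -/
theorem exists_solution [CharZero K] (h : IsInterpolation ψ Ψ) :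
    ∃ p : ℕ → K[X]⟦X⟧, (∀ m, ∃ N, ∀ a ≥ N, PowerSeries.coeff m (p a) = 0) ∧
      (∀ a, PowerSeries.coeff 0 (p a) = if a = 0 then Polynomial.X else if a = 1 then 1 else 0) ∧
      ∀ k, ∑ a ∈ Finset.range (k + 1), shiftedProd Ψ a k * p a = weightShift K k (Ψ (k + 1)) := by
  obtain ⟨x, hx0, hx⟩ := exists_series_solution
    -- The unknown at each order in h is finitely supported in a; this is what makes the solution
    -- summable.
    (fun i (c : ℕ →₀ K[X]) k => c.sum fun a q => PowerSeries.coeff i (shiftedProd Ψ a k) * q)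
    (symmetricSeq K)
    (fun i c => by
      have : (fun k => c.sum fun a q => PowerSeries.coeff i (shiftedProd Ψ a k) * q) =
          ∑ a ∈ c.support, fun k => PowerSeries.coeff i (shiftedProd Ψ a k) * c a := by
        funext k
        rw [Finset.sum_apply]
        rfl
      rw [this]
      exact (symmetricSeq K).sum_mem fun a _ => h.coeff_shiftedProd_mul_mem i a _)
    (fun t ht => by
      obtain ⟨c, hc⟩ := exists_newton_expansion_of_mem ht
      exact ⟨c, by simpa only [h.coeff_zero_shiftedProd] using hc⟩)
    (fun m k => PowerSeries.coeff m (weightShift K k (Ψ (k + 1))))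
    h.coeff_weightShift_succ_mem
    -- The classical solution: (k+1)(N+k) = N + k(N+k+1), that is, X⁺X⁻ = H + X⁻X⁺.
    (Finsupp.single 0 Polynomial.X + Finsupp.single 1 1)
    (by
      funext k
      rw [Finsupp.sum_add_index' (by simp) (by simp [mul_add]),
        Finsupp.sum_single_index (by simp), Finsupp.sum_single_index (by simp),
        h.coeff_zero_shiftedProd, h.coeff_zero_shiftedProd, coeff_weightShift, h.coeff_zero,
        newtonBasis_zero]
      simp only [newtonBasis, Finset.prod_range_one, Polynomial.mul_comp, Polynomial.C_comp,
        Polynomial.add_comp, Polynomial.sub_comp, Polynomial.X_comp, Polynomial.one_comp,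
        Nat.sub_zero, Nat.cast_zero, Nat.cast_add, Nat.cast_one, map_add, map_mul, map_one,
        map_ofNat, map_zero]
      ring)
  refine ⟨fun a => PowerSeries.mk fun m => x m a, fun m => ?_, fun a => ?_, fun k => ?_⟩
  · refine ⟨(x m).support.sup id + 1, fun a ha => ?_⟩
    rw [PowerSeries.coeff_mk]
    by_contra hne
    have := Finset.le_sup (f := id) (Finsupp.mem_support_iff.2 hne)
    simp only [id] at this
    omega
  · rw [PowerSeries.coeff_mk, hx0]
    rcases a with _ | _ | a <;> simp
  · ext1 m
    have := congrFun (hx m) k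
    simp only [Finset.sum_apply] at this
    rw [← this, map_sum]
    simp only [PowerSeries.coeff_mul, PowerSeries.coeff_mk]
    rw [Finset.sum_comm]
    refine Finset.sum_congr rfl fun p _ => ?_
    rw [Finsupp.sum]
    have hsupp : ∀ a, x p.2 a = 0 → PowerSeries.coeff p.1 (shiftedProd Ψ a k) * x p.2 a = 0 :=
      fun a ha => by rw [ha, mul_zero]
    have hk : ∀ a ∉ Finset.range (k + 1),
        PowerSeries.coeff p.1 (shiftedProd Ψ a k) * x p.2 a = 0 := fun a ha => by
      rw [h.shiftedProd_eq_zero (by have := mt Finset.mem_range.2 ha; omega), map_zero, zero_mul]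
    -- Both sums equal the sum over the union: terms with a > k have zero `shiftedProd`, terms off
    -- the support have zero coefficient.
    exact (Finset.sum_subset (Finset.subset_union_left (s₂ := (x p.2).support))
      fun a _ ha => hk a ha).trans (Finset.sum_subset
        (Finset.subset_union_right (s₁ := Finset.range (k + 1)))
          fun a _ ha => hsupp a (by simpa using ha)).symm

end IsInterpolation

/-- The family with values in `K⟦h⟧` interpolated by `p`. -/
def interpolated (p : ℕ → K[X]⟦X⟧) (a : ℕ) (n : ℤ) : K⟦X⟧ := evalAt (n : K) (p a)

theorem interpolates_interpolated (p : ℕ → K[X]⟦X⟧) : Interpolates p (interpolated p) :=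
  fun _ _ => rfl

theorem uniformlyBounded_of_eventually_zero {p : ℕ → K[X]⟦X⟧}
    (hp : ∀ m : ℕ, ∃ N : ℕ, ∀ a ≥ N, PowerSeries.coeff m (p a) = 0) : UniformlyBounded p := by
  intro m
  obtain ⟨N, hN⟩ := hp m
  refine ⟨(Finset.range N).sup fun a => (PowerSeries.coeff m (p a)).natDegree, fun k => ?_⟩
  rcases lt_or_ge k N with hk | hk
  · exact Finset.le_sup (f := fun a => (PowerSeries.coeff m (p a)).natDegree)
      (Finset.mem_range.2 hk)
  · simp [hN k hk]

theorem Interpolates.unique [CharZero K] {p p' : ℕ → K[X]⟦X⟧} {ξ : ℕ → ℤ → K⟦X⟧}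
    (hp : Interpolates p ξ) (hp' : Interpolates p' ξ) : p' = p :=
  funext fun a => eq_of_evalAt_int_lt 0 fun n _ => (hp' a n).trans (hp a n).symm

/-- The regular solutions of `ψ ⋉ ξ = ψ[+1]` are unique. -/
theorem IsRegularSolution.unique [CharZero K] {ψ : Colouring K} {ξ ξ' : ℕ → ℤ → K⟦X⟧}
    (hξ : IsRegularSolution ψ ξ) (hξ' : IsRegularSolution ψ ξ') : ξ' = ξ := by
  obtain ⟨-, hreg, hsol⟩ := hξ
  obtain ⟨-, hreg', hsol'⟩ := hξ'
  obtain ⟨p, -, hp⟩ := hreg.exists_interpolation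
  obtain ⟨p', -, hp'⟩ := hreg'.exists_interpolation
  funext k
  induction k using Nat.strong_induction_on with
  | _ k ih =>
    have hpp : p' k = p k := by
      -- N < -2k means n = N + 2k < 0, so b(n-b+1) ≠ 0 for all b ≥ 1 and the coefficient of ξ^k in
      -- the k-th equation can be cancelled.
      refine eq_of_evalAt_int_lt (-(2 * k : ℤ)) fun N hN => ?_
      rw [hp' k (Nat.zero_le _), hp k (Nat.zero_le _)]
      set n : ℤ := N + 2 * k with hn
      have h1 := congrFun (congrFun (hsol.trans hsol'.symm) k) n
      simp only [ltimes, Finset.sum_range_succ] at h1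
      have h2 : ∑ a ∈ Finset.range k,
          (∏ b ∈ Finset.Icc (k - a + 1) k, ψ.toFun b n) * ξ a (n - 2 * k) =
          ∑ a ∈ Finset.range k,
          (∏ b ∈ Finset.Icc (k - a + 1) k, ψ.toFun b n) * ξ' a (n - 2 * k) :=
        Finset.sum_congr rfl fun a ha => by rw [ih a (Finset.mem_range.1 ha)]
      rw [h2, add_right_inj] at h1
      have hne : ∏ b ∈ Finset.Icc (k - k + 1) k, ψ.toFun b n ≠ 0 := by
        refine Finset.prod_ne_zero_iff.2 fun b hb h0 => ?_
        have hb := Finset.mem_Icc.1 hb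
        have h3 := ψ.c1 b (by omega) n
        rw [h0, map_zero, eq_comm, mul_eq_zero] at h3
        rcases h3 with h3 | h3
        · have : b = 0 := by exact_mod_cast h3
          omega
        · have : n - b + 1 = 0 := by exact_mod_cast h3
          omega
      have h4 := mul_left_cancel₀ hne h1
      rw [show n - 2 * k = N by omega] at h4
      exact h4.symm
    funext n
    rw [← hp' k (Nat.zero_le _), ← hp k (Nat.zero_le _), hpp]

theorem IsInterpolation.isRegularSolution {ψ : Colouring K} {Ψ : ℕ → K[X]⟦X⟧}
    (h : IsInterpolation ψ Ψ) {p : ℕ → K[X]⟦X⟧}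
    (hp : ∀ m, ∃ N, ∀ a ≥ N, PowerSeries.coeff m (p a) = 0)
    (hsol : ∀ k, ∑ a ∈ Finset.range (k + 1), shiftedProd Ψ a k * p a =
      weightShift K k (Ψ (k + 1))) : IsRegularSolution ψ (interpolated p) := by
  refine ⟨isSummableSeq_of_interpolates (interpolates_interpolated p) hp,
    isRegularSeq_of_interpolates (interpolates_interpolated p)
      (uniformlyBounded_of_eventually_zero hp), ?_⟩
  funext k n
  have h1 := congrArg (ColouredKM.evalAt ((n - 2 * k : ℤ) : K)) (hsol k)
  rw [map_sum, evalAt_weightShift] at h1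
  rw [ltimes, Colouring.shift, ← h.evalAt (k + 1) (by omega)]
  refine Eq.trans (Finset.sum_congr rfl fun a ha => ?_) (h1.trans ?_)
  · rw [map_mul, h.evalAt_shiftedProd (by have := Finset.mem_range.1 ha; omega)]
    rfl
  · congr 2
    push_cast
    ring

end Equation

/-! ### The action on the deformed Verma modules -/

section Extension

variable {K A B : Type*} [Field K] [Semiring A] [Algebra K A] [Semiring B] [Algebra K B]

theorem coeff_hExtend (φ : A →ₐ[K] B⟦X⟧) (x : A⟦X⟧) (m : ℕ) :
    PowerSeries.coeff m (hExtend φ x) =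
      ∑ p ∈ antidiagonal m, PowerSeries.coeff p.2 (φ (PowerSeries.coeff p.1 x)) := by
  simp [hExtend]

theorem hExtend_C (φ : A →ₐ[K] B⟦X⟧) (x : A) : hExtend φ (PowerSeries.C x) = φ x := by
  ext m
  rw [coeff_hExtend, Finset.sum_eq_single (0, m)]
  · simp
  · rintro ⟨i, j⟩ hp hne
    have hi : i ≠ 0 := by
      rintro rfl
      simp at hp
      exact hne (by simp [hp])
    simp [PowerSeries.coeff_C, hi]
  · simp

theorem hExtend_X_mul (φ : A →ₐ[K] B⟦X⟧) (x : A⟦X⟧) :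
    hExtend φ (PowerSeries.X * x) = PowerSeries.X * hExtend φ x := by
  ext m
  rcases m with _ | m
  · rw [coeff_hExtend]
    simp
  · rw [coeff_hExtend, Finset.Nat.sum_antidiagonal_succ, PowerSeries.coeff_succ_X_mul,
      coeff_hExtend]
    simp [PowerSeries.coeff_succ_X_mul]

theorem hExtend_X_pow_mul (φ : A →ₐ[K] B⟦X⟧) (m : ℕ) (x : A⟦X⟧) :
    hExtend φ (PowerSeries.X ^ m * x) = PowerSeries.X ^ m * hExtend φ x := by
  induction m with
  | zero => simp
  | succ m ih => rw [pow_succ', mul_assoc, hExtend_X_mul, ih, pow_succ', mul_assoc]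

theorem aeval_of_eq_C (φ : A →ₐ[K] B⟦X⟧) {x : A} {y : B} (hxy : φ x = PowerSeries.C y)
    (q : K[X]) : φ (Polynomial.aeval x q) = PowerSeries.C (Polynomial.aeval y q) := by
  induction q using Polynomial.induction_on' with
  | add p q hp hq => rw [map_add, map_add, hp, hq, map_add, map_add]
  | monomial n a =>
    rw [Polynomial.aeval_monomial, Polynomial.aeval_monomial, map_mul, map_mul, map_pow,
      map_pow, hxy, AlgHom.commutes, PowerSeries.algebraMap_apply]

/-- The extension of `φ` is compatible with the substitution of `x` and `y = φ(x)` in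
elements of `K[T]⟦h⟧`. -/
theorem hExtend_aeval (φ : A →ₐ[K] B⟦X⟧) {x : A} {y : B} (hxy : φ x = PowerSeries.C y)
    {p : K[X]⟦X⟧} {u : A⟦X⟧} {v : B⟦X⟧}
    (hu : ∀ m, PowerSeries.coeff m u = Polynomial.aeval x (PowerSeries.coeff m p))
    (hv : ∀ m, PowerSeries.coeff m v = Polynomial.aeval y (PowerSeries.coeff m p)) :
    hExtend φ u = v := by
  ext m
  rw [coeff_hExtend, Finset.sum_eq_single (m, 0)]
  · simp [hu, hv, aeval_of_eq_C φ hxy]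
  · rintro ⟨i, j⟩ hp hne
    have hj : j ≠ 0 := by
      rintro rfl
      simp at hp
      exact hne (by simp [hp])
    simp [hu, aeval_of_eq_C φ hxy, PowerSeries.coeff_C, hj]
  · simp

end Extension

section EvalSeries

variable {K A : Type*} [Field K] [Ring A] [Algebra K A]

theorem coeff_evalSeries (x : A) (p : K[X]⟦X⟧) (m : ℕ) :
    PowerSeries.coeff m (evalSeries x p) = Polynomial.aeval x (PowerSeries.coeff m p) := rfl

theorem evalSeries_C (x : A) (q : K[X]) :
    evalSeries x (PowerSeries.C q) = PowerSeries.C (Polynomial.aeval x q) := by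
  simp [evalSeries]

end EvalSeries

namespace HSeries

variable {A V : Type*} [Semiring A] [AddCommGroup V] [Module A V]

protected theorem smul_zero (x : A⟦X⟧) : x • (0 : HSeries V) = 0 := _root_.smul_zero x

protected theorem zero_smul (v : HSeries V) : (0 : A⟦X⟧) • v = 0 := _root_.zero_smul _ v

protected theorem sum_smul {ι : Type*} (s : Finset ι) (f : ι → A⟦X⟧) (v : HSeries V) :
    (∑ i ∈ s, f i) • v = ∑ i ∈ s, f i • v := Finset.sum_smul

end HSeries

section Action

variable {K : Type*} [Field K]

/-- The vector `b_k` as a constant series. -/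
def basisVec (K : Type*) [Field K] (k : ℕ) : HSeries (V₀ K) :=
  fun m => if m = 0 then Finsupp.single k 1 else 0

theorem smul_basisVec_apply (y : (Module.End K (V₀ K))⟦X⟧) (k m : ℕ) :
    (y • basisVec K k) m = PowerSeries.coeff m y (Finsupp.single k 1) := by
  rw [HSeries.smul_apply, Finset.sum_eq_single (m, 0)]
  · simp [basisVec]
  · rintro ⟨i, j⟩ hp hne
    have hj : j ≠ 0 := by
      rintro rfl
      simp at hp
      exact hne (by simp [hp])
    simp [basisVec, hj]
  · simp

theorem scalar_smul_basisVec_apply (c : K⟦X⟧) (k m : ℕ) :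
    (c • basisVec K k) m = Finsupp.single k (PowerSeries.coeff m c) := by
  rw [← algebraMap_smul_eq, smul_basisVec_apply]
  change PowerSeries.coeff m (PowerSeries.map (algebraMap K (Module.End K (V₀ K))) c) _ = _
  rw [PowerSeries.coeff_map]
  simp [Module.algebraMap_end_apply]

theorem ext_basisVec {y y' : (Module.End K (V₀ K))⟦X⟧}
    (h : ∀ k, y • basisVec K k = y' • basisVec K k) : y = y' := by
  ext1 m
  refine Finsupp.lhom_ext' fun k => LinearMap.ext_ring ?_
  have := congrFun (h k) m
  rwa [smul_basisVec_apply, smul_basisVec_apply] at this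

theorem evalSeries_opH_smul (n : ℤ) (p : K[X]⟦X⟧) (k : ℕ) :
    evalSeries (opH n : Module.End K (V₀ K)) p • basisVec K k =
      evalAt ((n - 2 * k : ℤ) : K) p • basisVec K k := by
  ext1 m
  rw [smul_basisVec_apply, scalar_smul_basisVec_apply, coeff_evalAt]
  have hv : (opH n : Module.End K (V₀ K)).HasEigenvector ((n - 2 * k : ℤ) : K)
      (Finsupp.single k 1) := by
    rw [Module.End.hasEigenvector_iff, Module.End.mem_eigenspace_iff]
    refine ⟨?_, by simp⟩
    rw [opH_single]
    push_cast
    rfl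
  have := Module.End.aeval_apply_of_hasEigenvector (p := PowerSeries.coeff m p) hv
  refine Eq.trans ?_ (this.trans ?_)
  · rw [evalSeries, PowerSeries.coeff_map]
    rfl
  · simp

variable (ψ : Colouring K) (n : ℤ)

theorem vermaGen_Xm_pow_smul (a k : ℕ) :
    vermaGen ψ n .Xm ^ a • basisVec K k = basisVec K (k + a) := by
  induction a with
  | zero => simp
  | succ a ih =>
    rw [pow_succ', mul_smul, ih]
    ext1 m
    rw [smul_basisVec_apply]
    rcases m with _ | m
    · simp [vermaGen, basisVec, opXm_single, add_assoc]
    · simp [vermaGen, basisVec]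

theorem vermaGen_Xp_smul_zero : vermaGen ψ n .Xp • basisVec K 0 = 0 := by
  ext1 m
  rw [smul_basisVec_apply]
  simp [vermaGen, opXp_single_zero, HSeries.zero_apply]

theorem vermaGen_Xp_smul_succ (k : ℕ) :
    vermaGen ψ n .Xp • basisVec K (k + 1) = ψ.toFun (k + 1) n • basisVec K k := by
  ext1 m
  rw [smul_basisVec_apply, scalar_smul_basisVec_apply]
  simp [vermaGen, opXp_single_succ]

theorem vermaGen_Xp_pow_smul (a k : ℕ) :
    vermaGen ψ n .Xp ^ a • basisVec K (k + a) =
      (∏ b ∈ Finset.Icc (k + 1) (k + a), ψ.toFun b n) • basisVec K k := by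
  induction a with
  | zero => simp
  | succ a ih =>
    rw [pow_succ, mul_smul, ← add_assoc, vermaGen_Xp_smul_succ, smul_comm, ih, smul_smul,
      Finset.prod_Icc_succ_top (by omega), mul_comm]

theorem vermaGen_Xp_pow_smul_eq_zero {a k : ℕ} (hak : k < a) :
    vermaGen ψ n .Xp ^ a • basisVec K k = 0 := by
  obtain ⟨c, rfl⟩ := Nat.exists_eq_add_of_lt hak
  have := vermaGen_Xp_pow_smul ψ n k 0
  rw [zero_add] at this
  rw [show k + c + 1 = c + (1 + k) by ring, pow_add, pow_add, mul_smul, mul_smul, this, pow_one,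
    smul_comm (vermaGen ψ n .Xp), vermaGen_Xp_smul_zero, HSeries.smul_zero, HSeries.smul_zero]

/-- The action of `K⟨H, X⁻, X⁺⟩⟦h⟧` on the deformed Verma module. -/
def freeAct : FreeH K →+* (Module.End K (V₀ K))⟦X⟧ :=
  hExtend (FreeAlgebra.lift K (vermaGen ψ n))

theorem freeAct_gen (g : Gen) : freeAct ψ n (FreeH.gen K g) = vermaGen ψ n g := by
  rw [freeAct, FreeH.gen, hExtend_C, FreeAlgebra.lift_ι_apply]

theorem freeAct_evalSeries_smul (p : K[X]⟦X⟧) (k : ℕ) :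
    freeAct ψ n (evalSeries (FreeAlgebra.ι K Gen.H) p) • basisVec K k =
      evalAt ((n - 2 * k : ℤ) : K) p • basisVec K k := by
  have : freeAct ψ n (evalSeries (FreeAlgebra.ι K Gen.H) p) =
      evalSeries (opH n : Module.End K (V₀ K)) p :=
    hExtend_aeval (FreeAlgebra.lift K (vermaGen ψ n)) (FreeAlgebra.lift_ι_apply _ _)
      (coeff_evalSeries _ p) (coeff_evalSeries _ p)
  rw [this, evalSeries_opH_smul]

theorem freeAct_monomial_smul (a b : ℕ) (p : K[X]⟦X⟧) (k : ℕ) :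
    freeAct ψ n (FreeH.gen K .Xm ^ a * FreeH.gen K .Xp ^ b
        * evalSeries (FreeAlgebra.ι K Gen.H) p) • basisVec K (k + b) =
      ((∏ i ∈ Finset.Icc (k + 1) (k + b), ψ.toFun i n) *
        evalAt ((n - 2 * (k + b : ℕ) : ℤ) : K) p) • basisVec K (k + a) := by
  rw [map_mul, map_mul, map_pow, map_pow, freeAct_gen, freeAct_gen, mul_smul, mul_smul,
    freeAct_evalSeries_smul, smul_comm _ (evalAt _ _), vermaGen_Xp_pow_smul,
    smul_comm _ (evalAt _ _), smul_comm _ (∏ i ∈ _, _), vermaGen_Xm_pow_smul, smul_smul, mul_comm]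

theorem freeAct_monomial_smul_eq_zero (a : ℕ) {b k : ℕ} (hkb : k < b) (p : K[X]⟦X⟧) :
    freeAct ψ n (FreeH.gen K .Xm ^ a * FreeH.gen K .Xp ^ b
        * evalSeries (FreeAlgebra.ι K Gen.H) p) • basisVec K k = 0 := by
  rw [map_mul, map_mul, map_pow, map_pow, freeAct_gen, freeAct_gen, mul_smul, mul_smul,
    freeAct_evalSeries_smul, smul_comm _ (evalAt _ _), vermaGen_Xp_pow_smul_eq_zero _ _ hkb,
    HSeries.smul_zero, HSeries.smul_zero]

/-- The canonical homomorphism `K⟨H, X⁻, X⁺⟩⟦h⟧ → U(𝔞)⟦h⟧`. -/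
def toUha (K : Type*) [Field K] : FreeH K →ₐ[K⟦X⟧] Uha K where
  __ := PowerSeries.map (RingQuot.mkAlgHom K (NonDeformed K) : Free K →ₐ[K] Ua K).toRingHom
  commutes' c := by
    ext m
    change PowerSeries.coeff m (PowerSeries.map _ (PowerSeries.map (algebraMap K (Free K)) c)) =
      PowerSeries.coeff m (PowerSeries.map (algebraMap K (Ua K)) c)
    simp only [PowerSeries.coeff_map]
    exact AlgHom.commutes (RingQuot.mkAlgHom K (NonDeformed K) : Free K →ₐ[K] Ua K) _

theorem coeff_toUha (x : FreeH K) (m : ℕ) : PowerSeries.coeff m (toUha K x) =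
    RingQuot.mkAlgHom K (NonDeformed K) (PowerSeries.coeff m x) := rfl

theorem toUha_gen (g : Gen) : toUha K (FreeH.gen K g) = Uha.gen K g :=
  PowerSeries.map_C _ _

theorem toUha_surjective : Function.Surjective (toUha K) := by
  intro x
  choose f hf using RingQuot.mkAlgHom_surjective K (NonDeformed K)
  refine ⟨PowerSeries.mk fun m => f (PowerSeries.coeff m x), ?_⟩
  ext m
  rw [coeff_toUha, PowerSeries.coeff_mk]
  exact hf _

theorem toUha_evalSeries (p : K[X]⟦X⟧) :
    toUha K (evalSeries (FreeAlgebra.ι K Gen.H) p) = evalSeries (Ua.gen K .H) p := by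
  ext m
  rw [coeff_toUha]
  change RingQuot.mkAlgHom K (NonDeformed K) (Polynomial.aeval _ _) = Polynomial.aeval _ _
  exact (Polynomial.aeval_algHom_apply _ _ _).symm

theorem hExtend_vermaHom_toUha (x : FreeH K) :
    hExtend (vermaHom ψ n) (toUha K x) = freeAct ψ n x := by
  ext1 m
  rw [freeAct, coeff_hExtend, coeff_hExtend]
  refine Finset.sum_congr rfl fun p _ => ?_
  rw [coeff_toUha]
  congr 1
  exact RingQuot.liftAlgHom_mkAlgHom_apply K _ _ _

/-- A series of endomorphisms is determined by its values on the constant vectors b_k, so the ideal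
can be tested in End⟦h⟧. -/
theorem mem_vermaIdeal_iff (x : Uha K) :
    x ∈ vermaIdeal ψ ↔ ∀ n, hExtend (vermaHom ψ n) x = 0 := by
  rw [mem_vermaIdeal]
  refine forall_congr' fun n => ⟨fun h => ext_basisVec fun k => ?_, fun h v => ?_⟩
  · rw [HSeries.zero_smul]
    exact h (basisVec K k)
  · change hExtend (vermaHom ψ n) x • v = 0
    rw [h, HSeries.zero_smul]

theorem toUha_mem_vermaIdeal_iff (x : FreeH K) :
    toUha K x ∈ vermaIdeal ψ ↔ ∀ n, freeAct ψ n x = 0 := by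
  simp only [mem_vermaIdeal_iff, hExtend_vermaHom_toUha]

/-- The canonical homomorphism `K⟨H, X⁻, X⁺⟩⟦h⟧ → U_h(ψ)`. -/
def toUh : FreeH K →ₐ[K⟦X⟧] Uh ψ := (Ideal.Quotient.mkₐ K⟦X⟧ (vermaIdeal ψ)).comp (toUha K)

theorem toUh_apply (x : FreeH K) : toUh ψ x = Ideal.Quotient.mk (vermaIdeal ψ) (toUha K x) := rfl

theorem toUh_gen (g : Gen) : toUh ψ (FreeH.gen K g) = Uh.gen ψ g := by
  rw [toUh_apply, toUha_gen, Uh.gen]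

theorem toUh_surjective : Function.Surjective (toUh ψ) :=
  Ideal.Quotient.mk_surjective.comp toUha_surjective

theorem toUh_eq_zero_iff (x : FreeH K) : toUh ψ x = 0 ↔ ∀ n, freeAct ψ n x = 0 := by
  rw [toUh_apply, Ideal.Quotient.eq_zero_iff_mem, toUha_mem_vermaIdeal_iff]

variable {ψ}

/-- A solution of `ψ ⋉ ξ = ψ[+1]` gives the value of `X⁺ X⁻` on the deformed Verma modules. -/
theorem freeAct_Xp_mul_Xm {ξ : ℕ → ℤ → K⟦X⟧} (hξ : ltimes ψ ξ = ψ.shift)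
    {p : ℕ → K[X]⟦X⟧} (hp : Interpolates p ξ) {r : FreeH K}
    (hr : HasHSum K (fun a => FreeH.gen K .Xm ^ a * FreeH.gen K .Xp ^ a
      * evalSeries (FreeAlgebra.ι K Gen.H) (p a)) r) :
    freeAct ψ n (FreeH.gen K .Xp * FreeH.gen K .Xm) = freeAct ψ n r := by
  refine ext_basisVec fun k => ?_
  have h1 : freeAct ψ n (FreeH.gen K .Xp * FreeH.gen K .Xm) • basisVec K k =
      ψ.toFun (k + 1) n • basisVec K k := by
    have := vermaGen_Xm_pow_smul ψ n 1 k
    rw [pow_one] at this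
    rw [map_mul, freeAct_gen, freeAct_gen, mul_smul, this, vermaGen_Xp_smul_succ]
  -- (X⁺)^a kills b_k for a > k, so on b_k the partial sums are constant from N = k + 1 on.
  have h2 : ∀ N ≥ k + 1, freeAct ψ n (∑ a ∈ Finset.range N,
      FreeH.gen K .Xm ^ a * FreeH.gen K .Xp ^ a * evalSeries (FreeAlgebra.ι K Gen.H) (p a)) •
        basisVec K k = ψ.toFun (k + 1) n • basisVec K k := by
    intro N hN
    have h3 := congrFun (congrFun hξ k) n
    rw [Colouring.shift] at h3
    rw [← h3, ltimes, map_sum, HSeries.sum_smul, HSeries.sum_smul]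
    refine ((Finset.sum_subset (Finset.range_mono hN) fun a _ ha => ?_).trans rfl).symm.trans
      (Finset.sum_congr rfl fun a ha => ?_)
    · exact freeAct_monomial_smul_eq_zero ψ n a
        (by have := mt Finset.mem_range.2 ha; omega) (p a)
    · obtain ⟨c, rfl⟩ := Nat.exists_eq_add_of_le (Nat.lt_succ_iff.1 (Finset.mem_range.1 ha))
      rw [add_comm a c, freeAct_monomial_smul, Nat.add_sub_cancel, ← hp a]
  rw [h1]
  ext1 m
  -- An error divisible by h^(m+1) does not affect the coefficient of h^m.
  obtain ⟨N₀, hN₀⟩ := hasHSum_iff.1 hr (m + 1)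
  obtain ⟨z, hz⟩ := hN₀ (max N₀ (k + 1)) (le_max_left _ _)
  rw [← h2 _ (le_max_right N₀ (k + 1)), smul_basisVec_apply, smul_basisVec_apply]
  congr 1
  rw [sub_eq_iff_eq_add.1 hz, X_pow_hsmul, map_add, map_add, freeAct, hExtend_X_pow_mul]
  rw [PowerSeries.coeff_X_pow_mul', if_neg (by omega), zero_add]

end Action

/-! ### Monomials `F^a E^b H^c` -/

section PBW

variable {K A : Type*} [Field K] [Ring A] [Algebra K A]

/-- The span of the monomials `F^a E^b H^c`. -/
def pbwSpan (K : Type*) {A : Type*} [Field K] [Ring A] [Algebra K A] (H F E : A) : Submodule K A :=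
  Submodule.span K (Set.range fun t : ℕ × ℕ × ℕ => F ^ t.1 * E ^ t.2.1 * H ^ t.2.2)

theorem monomial_mem_pbwSpan (H F E : A) (a b c : ℕ) : F ^ a * E ^ b * H ^ c ∈ pbwSpan K H F E :=
  Submodule.subset_span ⟨(a, b, c), rfl⟩

theorem mul_pow_of_commutator {H Y : A} {c : K} (h : H * Y = Y * H + c • Y) (a : ℕ) :
    H * Y ^ a = Y ^ a * H + ((a : K) * c) • Y ^ a := by
  induction a with
  | zero => simp
  | succ a ih =>
    rw [pow_succ, ← mul_assoc, ih, add_mul, mul_assoc, h, smul_mul_assoc, mul_add, mul_smul_comm,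
      ← mul_assoc]
    push_cast
    module

variable {H F E : A}

/-- The sl₂ identity [E, F^(a+1)] = (a+1) F^a (H - a), written with exponent a + 1 to avoid
subtraction in ℕ. -/
theorem mul_pow_succ_of_commutator (hHF : H * F = F * H + (-2 : K) • F) (hEF : E * F = H + F * E)
    (a : ℕ) : E * F ^ (a + 1) =
      F ^ (a + 1) * E + ((a : K) + 1) • (F ^ a * H) - ((a : K) * (a + 1)) • F ^ a := by
  induction a with
  | zero => simp [hEF, add_comm]
  | succ a ih =>
    have h1 : F ^ a * H * F = F ^ (a + 1) * H + (-2 : K) • F ^ (a + 1) := by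
      rw [mul_assoc, hHF, mul_add, mul_smul_comm, ← mul_assoc, ← pow_succ]
    have h2 : F ^ (a + 1) * E * F = F ^ (a + 1) * H + F ^ (a + 1 + 1) * E := by
      rw [mul_assoc, hEF, mul_add, ← mul_assoc, ← pow_succ]
    rw [pow_succ F (a + 1), ← mul_assoc, ih, sub_mul, add_mul, smul_mul_assoc, smul_mul_assoc,
      h1, h2, ← pow_succ, ← pow_succ]
    push_cast
    module

theorem mul_mem_pbwSpan {g : A} (hg : ∀ a b c, g * (F ^ a * E ^ b * H ^ c) ∈ pbwSpan K H F E)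
    {s : A} (hs : s ∈ pbwSpan K H F E) : g * s ∈ pbwSpan K H F E := by
  induction hs using Submodule.span_induction with
  | mem x hx => obtain ⟨t, rfl⟩ := hx; exact hg _ _ _
  | zero => rw [mul_zero]; exact zero_mem _
  | add x y _ _ hx hy => rw [mul_add]; exact add_mem hx hy
  | smul c x _ hx => rw [mul_smul_comm]; exact Submodule.smul_mem _ _ hx

/-- If `[H, E] = 2E`, `[H, F] = -2F` and `[E, F] = H`, then the subalgebra generated by `H, F, E` is
spanned by the monomials `F^a E^b H^c`. -/
theorem mem_pbwSpan (f : FreeAlgebra K Gen →ₐ[K] A)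
    (hH : f (FreeAlgebra.ι K .H) = H) (hF : f (FreeAlgebra.ι K .Xm) = F)
    (hE : f (FreeAlgebra.ι K .Xp) = E)
    (hHE : H * E = E * H + (2 : K) • E) (hHF : H * F = F * H + (-2 : K) • F)
    (hEF : E * F = H + F * E) (x : FreeAlgebra K Gen) : f x ∈ pbwSpan K H F E := by
  -- Stability of the span under left multiplication passes to products; the claim itself is the
  -- case s = 1.
  have key : ∀ s ∈ pbwSpan K H F E, f x * s ∈ pbwSpan K H F E := by
    induction x using FreeAlgebra.induction with
    | grade0 r =>
      intro s hs
      rw [AlgHom.commutes, ← Algebra.smul_def]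
      exact Submodule.smul_mem _ _ hs
    | grade1 g =>
      intro s hs
      refine mul_mem_pbwSpan (fun a b c => ?_) hs
      cases g with
      | H =>
        rw [hH, ← mul_assoc, ← mul_assoc, mul_pow_of_commutator hHF, add_mul, add_mul, mul_assoc _ H,
          mul_pow_of_commutator hHE, smul_mul_assoc, smul_mul_assoc, mul_add, add_mul,
          mul_smul_comm, smul_mul_assoc, ← mul_assoc, mul_assoc _ H, ← pow_succ']
        exact add_mem (add_mem (monomial_mem_pbwSpan _ _ _ _ _ _)
          (Submodule.smul_mem _ _ (monomial_mem_pbwSpan _ _ _ _ _ _)))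
          (Submodule.smul_mem _ _ (monomial_mem_pbwSpan _ _ _ _ _ _))
      | Xm =>
        rw [hF, ← mul_assoc, ← mul_assoc, ← pow_succ']
        exact monomial_mem_pbwSpan _ _ _ _ _ _
      | Xp =>
        rw [hE]
        rcases a with _ | a
        · rw [pow_zero, one_mul, ← mul_assoc, ← pow_succ']
          simpa using monomial_mem_pbwSpan (K := K) H F E 0 (b + 1) c
        · rw [← mul_assoc, ← mul_assoc, mul_pow_succ_of_commutator hHF hEF, sub_mul, sub_mul,
            add_mul, add_mul, mul_assoc _ E, ← pow_succ', smul_mul_assoc, mul_assoc _ H,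
            mul_pow_of_commutator hHE, smul_mul_assoc, smul_mul_assoc, smul_mul_assoc, mul_add,
            add_mul, mul_smul_comm, smul_mul_assoc, ← mul_assoc (F ^ a), mul_assoc _ H, ← pow_succ']
          exact sub_mem (add_mem (monomial_mem_pbwSpan _ _ _ _ _ _) (Submodule.smul_mem _ _
            (add_mem (monomial_mem_pbwSpan _ _ _ _ _ _)
              (Submodule.smul_mem _ _ (monomial_mem_pbwSpan _ _ _ _ _ _)))))
            (Submodule.smul_mem _ _ (monomial_mem_pbwSpan _ _ _ _ _ _))
    | mul x y hx hy =>
      intro s hs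
      rw [map_mul, mul_assoc]
      exact hx _ (hy _ hs)
    | add x y hx hy =>
      intro s hs
      rw [map_add, add_mul]
      exact add_mem (hx s hs) (hy s hs)
  have := key 1 (by simpa using monomial_mem_pbwSpan (K := K) H F E 0 0 0)
  rwa [mul_one] at this

theorem exists_sum_of_mem_pbwSpan {x : A} (hx : x ∈ pbwSpan K H F E) :
    ∃ c : (ℕ × ℕ) →₀ K[X], x = c.sum fun t q => F ^ t.1 * E ^ t.2 * Polynomial.aeval H q := by
  induction hx using Submodule.span_induction with
  | mem x hx =>
    obtain ⟨⟨a, b, c⟩, rfl⟩ := hx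
    exact ⟨Finsupp.single (a, b) (Polynomial.X ^ c), by rw [Finsupp.sum_single_index] <;> simp⟩
  | zero => exact ⟨0, by simp⟩
  | add x y _ _ hx hy =>
    obtain ⟨c, rfl⟩ := hx
    obtain ⟨d, rfl⟩ := hy
    exact ⟨c + d, by rw [Finsupp.sum_add_index'] <;> simp [mul_add]⟩
  | smul r x _ hx =>
    obtain ⟨c, rfl⟩ := hx
    refine ⟨r • c, ?_⟩
    rw [Finsupp.sum_smul_index' (by simp), Finsupp.smul_sum]
    simp

end PBW

/-! ### Faithfulness modulo `h` -/

section Faithful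

variable {K : Type*} [Field K] (ψ : Colouring K)

theorem freeAct_C_monomial (n : ℤ) (a b : ℕ) (q : K[X]) :
    FreeAlgebra.lift K (vermaGen ψ n) (FreeAlgebra.ι K .Xm ^ a * FreeAlgebra.ι K .Xp ^ b
      * Polynomial.aeval (FreeAlgebra.ι K .H) q) =
    freeAct ψ n (FreeH.gen K .Xm ^ a * FreeH.gen K .Xp ^ b
        * evalSeries (FreeAlgebra.ι K Gen.H) (PowerSeries.C q)) := by
  rw [← hExtend_C, evalSeries_C, FreeH.gen, FreeH.gen, freeAct, ← map_pow, ← map_pow, ← map_mul,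
    ← map_mul]

/-- An element of the span of the monomials `(X⁻)^a (X⁺)^b H^c` acting by zero modulo `h` on all
the deformed Verma modules is zero. -/
theorem eq_zero_of_mem_pbwSpan [CharZero K] {y : Free K}
    (hy : y ∈ pbwSpan K (FreeAlgebra.ι K Gen.H) (FreeAlgebra.ι K Gen.Xm) (FreeAlgebra.ι K Gen.Xp))
    (h0 : ∀ n, PowerSeries.coeff 0 (FreeAlgebra.lift K (vermaGen ψ n) y) = 0) : y = 0 := by
  obtain ⟨c, rfl⟩ := exists_sum_of_mem_pbwSpan hy
  suffices hc : ∀ k a, c (a, k) = 0 by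
    have : c = 0 := Finsupp.ext fun t => hc t.2 t.1
    rw [this, Finsupp.sum_zero_index]
  intro k
  induction k using Nat.strong_induction_on with
  | _ k ih =>
    intro a
    refine polynomial_eq_of_eval_int_lt (-(2 * k : ℤ)) fun N hN => ?_
    rw [Polynomial.eval_zero]
    set n : ℤ := N + 2 * k with hn
    -- The coefficient of b_a modulo h in the image of b_k under the monomials indexed by t = (i,
    -- j). Those with j < k are gone by induction, those with j > k kill b_k, and those with j = k
    -- send b_k to a multiple of b_i; only (a, k) can contribute.
    let term (t : ℕ × ℕ) : K := (freeAct ψ n (FreeH.gen K .Xm ^ t.1 * FreeH.gen K .Xp ^ t.2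
      * evalSeries (FreeAlgebra.ι K Gen.H) (PowerSeries.C (c t))) • basisVec K k) 0 a
    have h1 : ∑ t ∈ c.support, term t = 0 := by
      have := congrArg (fun u : Module.End K (V₀ K) => u (Finsupp.single k 1) a) (h0 n)
      simp only [Finsupp.sum, map_sum, freeAct_C_monomial, LinearMap.sum_apply,
        Finsupp.finsetSum_apply] at this
      simp only [term, smul_basisVec_apply]
      exact this
    have hz : ∀ t, c t = 0 → term t = 0 := fun t ht => by
      simp only [term, ht, map_zero]
      rw [show evalSeries (FreeAlgebra.ι K Gen.H) (0 : K[X]⟦X⟧) = 0 from map_zero _, mul_zero,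
        map_zero, HSeries.zero_smul]
      rfl
    have h2 : ∀ t, t ≠ (a, k) → term t = 0 := by
      rintro ⟨i, j⟩ hne
      rcases lt_trichotomy j k with hj | rfl | hj
      · exact hz _ (ih j hj i)
      · have := freeAct_monomial_smul ψ n i j (PowerSeries.C (c (i, j))) 0
        rw [zero_add, zero_add, zero_add] at this
        have hia : i ≠ a := fun h => hne (by rw [h])
        simp only [term]
        rw [this, scalar_smul_basisVec_apply, Finsupp.single_apply, if_neg hia]
      · simp only [term]
        rw [freeAct_monomial_smul_eq_zero ψ n i hj]
        rfl
    have h3 : term (a, k) = 0 := by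
      by_cases hs : (a, k) ∈ c.support
      · rwa [Finset.sum_eq_single_of_mem (a, k) hs fun t _ ht => h2 t ht] at h1
      · exact hz _ (Finsupp.notMem_support_iff.1 hs)
    have h4 := freeAct_monomial_smul ψ n a k (PowerSeries.C (c (a, k))) 0
    rw [zero_add, zero_add, zero_add] at h4
    simp only [term] at h3
    rw [h4, scalar_smul_basisVec_apply, Finsupp.single_eq_same,
      PowerSeries.coeff_zero_eq_constantCoeff_apply, map_mul, map_prod,
      ← PowerSeries.coeff_zero_eq_constantCoeff_apply, coeff_evalAt, mul_eq_zero,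
      PowerSeries.coeff_zero_C, show n - 2 * (k : ℕ) = N by omega] at h3
    -- Since n < 0, no factor b(n-b+1) with b ≥ 1 vanishes.
    refine h3.resolve_left (Finset.prod_ne_zero_iff.2 fun b hb h5 => ?_)
    have hb := Finset.mem_Icc.1 hb
    rw [ψ.c1 b (by omega), mul_eq_zero] at h5
    rcases h5 with h5 | h5
    · have : b = 0 := by exact_mod_cast h5
      omega
    · have : n - b + 1 = 0 := by exact_mod_cast h5
      omega

end Faithful

/-! ### The presentation of `U_h(ψ)` -/

section Relations

variable {K : Type*} [Field K]

theorem Ua.gen_H_Xp : Ua.gen K .H * Ua.gen K .Xp - Ua.gen K .Xp * Ua.gen K .H =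
    2 * Ua.gen K .Xp := by
  have := RingQuot.mkAlgHom_rel K (NonDeformed.plus (K := K))
  rw [map_sub, map_mul, map_mul, map_mul, map_ofNat] at this
  exact this

theorem Ua.gen_H_Xm : Ua.gen K .H * Ua.gen K .Xm - Ua.gen K .Xm * Ua.gen K .H =
    -(2 * Ua.gen K .Xm) := by
  have := RingQuot.mkAlgHom_rel K (NonDeformed.minus (K := K))
  rw [map_sub, map_mul, map_mul, map_neg, map_mul, map_ofNat] at this
  exact this

variable (ψ : Colouring K)

/-- The homomorphism `U(𝔞) → U_h(ψ)`. -/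
def uaToUh : Ua K →+* Uh ψ :=
  (Ideal.Quotient.mk (vermaIdeal ψ)).comp PowerSeries.C

theorem uaToUh_gen (g : Gen) : uaToUh ψ (Ua.gen K g) = Uh.gen ψ g := rfl

theorem Uh.gen_H_Xp : Uh.gen ψ .H * Uh.gen ψ .Xp - Uh.gen ψ .Xp * Uh.gen ψ .H =
    2 * Uh.gen ψ .Xp := by
  simp only [← uaToUh_gen]
  rw [← map_mul, ← map_mul, ← map_sub, Ua.gen_H_Xp, map_mul, map_ofNat]

theorem Uh.gen_H_Xm : Uh.gen ψ .H * Uh.gen ψ .Xm - Uh.gen ψ .Xm * Uh.gen ψ .H =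
    -(2 * Uh.gen ψ .Xm) := by
  simp only [← uaToUh_gen]
  rw [← map_mul, ← map_mul, ← map_sub, Ua.gen_H_Xm, map_neg, map_mul, map_ofNat]

end Relations

/-! ### Density of the subalgebra generated by H, X⁻, X⁺. -/

section Density

variable {K : Type*} [Field K]

theorem C_mem_adjoin_gen (x : Free K) :
    (PowerSeries.C x : FreeH K) ∈ Algebra.adjoin K⟦X⟧ (Set.range (FreeH.gen K)) := by
  induction x using FreeAlgebra.induction with
  | grade0 r =>
    have : (PowerSeries.C (algebraMap K (Free K) r) : FreeH K) =
        algebraMap K⟦X⟧ (FreeH K) (PowerSeries.C r) := by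
      change _ = PowerSeries.map (algebraMap K (Free K)) (PowerSeries.C r)
      rw [PowerSeries.map_C]
    rw [this]
    exact Subalgebra.algebraMap_mem _ _
  | grade1 g => exact Algebra.subset_adjoin ⟨g, rfl⟩
  | mul x y hx hy => rw [map_mul]; exact mul_mem hx hy
  | add x y hx hy => rw [map_add]; exact add_mem hx hy

theorem exists_eq_C_add_X_mul {A : Type*} [Ring A] (x : A⟦X⟧) :
    ∃ z, x = PowerSeries.C (PowerSeries.coeff 0 x) + PowerSeries.X * z := by
  refine ⟨PowerSeries.mk fun m => PowerSeries.coeff (m + 1) x, ?_⟩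
  ext m
  rcases m with _ | m
  · simp
  · simp [PowerSeries.coeff_succ_X_mul]

theorem X_hsmul (x : FreeH K) : (PowerSeries.X : K⟦X⟧) • x = PowerSeries.X * x := by
  simpa using X_pow_hsmul (K := K) 1 x

/-- Constant coefficients are noncommutative polynomials in the generators, so they can be peeled
off one power of h at a time. -/
theorem exists_adjoin_gen_approx (m : ℕ) (x : FreeH K) :
    ∃ y ∈ Algebra.adjoin K⟦X⟧ (Set.range (FreeH.gen K)),
      ∃ z, x = y + (PowerSeries.X : K⟦X⟧) ^ m • z := by
  induction m generalizing x with
  | zero => exact ⟨0, zero_mem _, x, by simp⟩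
  | succ m ih =>
    obtain ⟨w, hw⟩ := exists_eq_C_add_X_mul x
    obtain ⟨y, hy, z, hz⟩ := ih w
    refine ⟨PowerSeries.C (PowerSeries.coeff 0 x) + (PowerSeries.X : K⟦X⟧) • y,
      add_mem (C_mem_adjoin_gen _) (Subalgebra.smul_mem _ hy _), z, ?_⟩
    rw [pow_succ', mul_smul, add_assoc, ← smul_add, ← hz, X_hsmul]
    exact hw

theorem topologicallyGenerates_gen (ψ : Colouring K) :
    TopologicallyGenerates K (Set.range (Uh.gen ψ)) := by
  rw [TopologicallyGenerates, Set.eq_univ_iff_forall]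
  intro x
  obtain ⟨x, rfl⟩ := toUh_surjective ψ x
  rw [mem_hClosure_iff]
  intro m
  obtain ⟨y, hy, z, hz⟩ := exists_adjoin_gen_approx m x
  refine ⟨toUh ψ y, ?_, toUh ψ (-z), ?_⟩
  · have : (Algebra.adjoin K⟦X⟧ (Set.range (FreeH.gen K))).map (toUh ψ) =
        Algebra.adjoin K⟦X⟧ (Set.range (Uh.gen ψ)) := by
      rw [AlgHom.map_adjoin, ← Set.range_comp]
      congr 2
      funext g
      exact toUh_gen ψ g
    rw [← this]
    exact ⟨y, hy, rfl⟩
  · rw [← map_smul, ← map_sub, hz]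
    congr 1
    rw [smul_neg]
    abel

end Density

/-! ### The kernel of K⟨H, X⁻, X⁺⟩⟦h⟧ → U_h(ψ) is the closed ideal of the relations. -/

section Kernel

variable {K : Type*} [Field K] (ψ : Colouring K)

/-- U_h(ψ) has no h-torsion, because it embeds into a product of copies of End⟦h⟧. -/
theorem toUh_X_pow_smul_eq_zero {m : ℕ} {x : FreeH K}
    (h : toUh ψ ((PowerSeries.X : K⟦X⟧) ^ m • x) = 0) : toUh ψ x = 0 := by
  rw [toUh_eq_zero_iff] at h ⊢
  intro n
  have := h n
  rw [X_pow_hsmul, freeAct, hExtend_X_pow_mul] at this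
  ext1 i
  have h1 := congrArg (PowerSeries.coeff (i + m)) this
  rw [PowerSeries.coeff_X_pow_mul] at h1
  exact h1

/-- The action commutes with h, so a limit of elements acting by zero acts by zero modulo every
power of h. -/
theorem isClosed_ker_toUh :
    @IsClosed _ (hTopology K (FreeH K)) (RingHom.ker (toUh ψ) : Set (FreeH K)) := by
  let := hTopology K (FreeH K)
  refine isClosed_of_closure_subset fun x hx => ?_
  change toUh ψ x = 0
  rw [toUh_eq_zero_iff]
  intro n
  ext1 m
  obtain ⟨y, hy, z, hz⟩ := mem_hClosure_iff.1 hx (m + 1)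
  have hy' := (toUh_eq_zero_iff ψ y).1 hy n
  rw [sub_eq_iff_eq_add.1 hz, X_pow_hsmul, map_add, freeAct, hExtend_X_pow_mul] at hy'
  have h1 := congrArg (PowerSeries.coeff m) hy'
  rw [map_add, PowerSeries.coeff_X_pow_mul', if_neg (by omega), zero_add] at h1
  exact h1

theorem isClosed_closedIdeal {A : Type*} [Ring A] [Algebra K⟦X⟧ A] (S : Set A) :
    @IsClosed A (hTopology K A) (closedIdeal K S : Set A) := by
  let := hTopology K A
  rw [closedIdeal, Submodule.coe_sInf]
  exact isClosed_biInter fun I hI => hI.2.1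

theorem subset_closedIdeal {A : Type*} [Ring A] [Algebra K⟦X⟧ A] (S : Set A) :
    S ⊆ (closedIdeal K S : Set A) := by
  intro x hx
  rw [closedIdeal, SetLike.mem_coe, Submodule.mem_sInf]
  exact fun I hI => hI.2.2 hx

variable {ψ}

theorem closedIdeal_le_ker_toUh {r : FreeH K}
    (hr : toUh ψ (FreeH.gen K .Xp * FreeH.gen K .Xm) = toUh ψ r) :
    closedIdeal K (relators r) ≤ RingHom.ker (toUh ψ) := by
  refine sInf_le ⟨inferInstance, isClosed_ker_toUh ψ, ?_⟩
  rintro x (rfl | rfl | rfl)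
  · change toUh ψ _ = 0
    rw [map_sub, map_sub, map_mul, map_mul, map_mul, map_ofNat, toUh_gen, toUh_gen,
      Uh.gen_H_Xp, sub_self]
  · change toUh ψ _ = 0
    rw [map_add, map_sub, map_mul, map_mul, map_mul, map_ofNat, toUh_gen, toUh_gen,
      Uh.gen_H_Xm, neg_add_cancel]
  · change toUh ψ _ = 0
    rw [map_sub, hr, sub_self]

/-- The ideal generated by `I` and `h`. -/
def addX {A : Type*} [Ring A] (I : Ideal A⟦X⟧) : Ideal A⟦X⟧ :=
  I ⊔ Ideal.span {PowerSeries.X}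

theorem mem_addX {A : Type*} [Ring A] {I : Ideal A⟦X⟧} {x : A⟦X⟧} :
    x ∈ addX I ↔ ∃ i ∈ I, ∃ z, x = i + PowerSeries.X * z := by
  rw [addX, Submodule.mem_sup]
  refine exists_congr fun i => and_congr_right fun _ => ⟨?_, ?_⟩
  · rintro ⟨y, hy, rfl⟩
    obtain ⟨z, rfl⟩ := Ideal.mem_span_singleton'.1 hy
    exact ⟨z, by rw [(PowerSeries.commute_X z).eq]⟩
  · rintro ⟨z, rfl⟩
    exact ⟨_, Ideal.mem_span_singleton'.2 ⟨z, (PowerSeries.commute_X z).eq⟩, rfl⟩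

instance addX_isTwoSided {A : Type*} [Ring A] (I : Ideal A⟦X⟧) [I.IsTwoSided] :
    (addX I).IsTwoSided where
  mul_mem_of_left b ha := by
    obtain ⟨i, hi, z, rfl⟩ := mem_addX.1 ha
    exact mem_addX.2 ⟨i * b, Ideal.IsTwoSided.mul_mem_of_left b hi, z * b, by
      rw [add_mul, mul_assoc]⟩

/-- Modulo `h` and the relations, every element of `K⟨H, X⁻, X⁺⟩` is in the span of the monomials
`(X⁻)^a (X⁺)^b H^c`. -/
theorem exists_pbwSpan_sub_mem {r : FreeH K}
    (hr0 : PowerSeries.coeff 0 r = FreeAlgebra.ι K Gen.H +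
      FreeAlgebra.ι K Gen.Xm * FreeAlgebra.ι K Gen.Xp) (x : Free K) :
    ∃ y ∈ pbwSpan K (FreeAlgebra.ι K Gen.H) (FreeAlgebra.ι K Gen.Xm) (FreeAlgebra.ι K Gen.Xp),
      (PowerSeries.C x : FreeH K) - PowerSeries.C y ∈ addX (closedIdeal K (relators r)) := by
  set T := addX (closedIdeal K (relators r)) with hT
  have hIT : ∀ x ∈ relators r, x ∈ T := fun x hx =>
    mem_addX.2 ⟨x, subset_closedIdeal _ hx, 0, by simp⟩
  -- In the quotient by the relations and h the generators satisfy the sl₂ relations, so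
  -- `mem_pbwSpan` applies to it as a K-algebra.
  let f : Free K →ₐ[K] (FreeH K ⧸ T) :=
    (Ideal.Quotient.mkₐ K T).comp
      { (PowerSeries.C : Free K →+* FreeH K) with
        commutes' := fun c => (PowerSeries.algebraMap_apply).symm }
  have hf : ∀ x, f x = Ideal.Quotient.mk T (PowerSeries.C x) := fun _ => rfl
  have h2 : ∀ z : FreeH K, Ideal.Quotient.mk T (2 * z) = (2 : K) • Ideal.Quotient.mk T z :=
    fun z => by rw [two_mul, map_add, two_smul]
  have key := mem_pbwSpan f rfl rfl rfl (by
      rw [← sub_eq_iff_eq_add', ← sub_eq_zero]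
      have := Ideal.Quotient.eq_zero_iff_mem.2 (hIT _ (Or.inl rfl))
      rwa [map_sub, map_sub, map_mul, map_mul, h2] at this) (by
      rw [← sub_eq_iff_eq_add', ← sub_eq_zero, neg_smul, sub_neg_eq_add]
      have := Ideal.Quotient.eq_zero_iff_mem.2 (hIT _ (Or.inr (Or.inl rfl)))
      rwa [map_add, map_sub, map_mul, map_mul, h2] at this) (by
      have h3 := Ideal.Quotient.eq_zero_iff_mem.2 (hIT _ (Or.inr (Or.inr rfl)))
      obtain ⟨z, hz⟩ := exists_eq_C_add_X_mul r
      have h4 : Ideal.Quotient.mk T r = Ideal.Quotient.mk T (PowerSeries.C (PowerSeries.coeff 0 r)) :=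
        Ideal.Quotient.eq.2 (mem_addX.2 ⟨0, zero_mem _, z, by
          rw [zero_add, sub_eq_iff_eq_add']; exact hz⟩)
      rw [map_sub, map_mul, sub_eq_zero, h4, hr0, ← hf, map_add, map_mul] at h3
      exact h3) x
  have hmap : pbwSpan K (f (FreeAlgebra.ι K Gen.H)) (f (FreeAlgebra.ι K Gen.Xm))
      (f (FreeAlgebra.ι K Gen.Xp)) = (pbwSpan K (FreeAlgebra.ι K Gen.H) (FreeAlgebra.ι K Gen.Xm)
        (FreeAlgebra.ι K Gen.Xp)).map f.toLinearMap := by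
    rw [pbwSpan, pbwSpan, Submodule.map_span, ← Set.range_comp]
    congr 2
    funext t
    simp
  rw [hmap] at key
  obtain ⟨y, hy, hyx⟩ := key
  exact ⟨y, hy, Ideal.Quotient.eq.1 hyx.symm⟩

theorem ker_toUh_le_closedIdeal [CharZero K] {r : FreeH K}
    (hr : toUh ψ (FreeH.gen K .Xp * FreeH.gen K .Xm) = toUh ψ r)
    (hr0 : PowerSeries.coeff 0 r = FreeAlgebra.ι K Gen.H +
      FreeAlgebra.ι K Gen.Xm * FreeAlgebra.ι K Gen.Xp) :
    RingHom.ker (toUh ψ) ≤ closedIdeal K (relators r) := by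
  set I := closedIdeal K (relators r) with hI
  have hle : ∀ x ∈ I, toUh ψ x = 0 := closedIdeal_le_ker_toUh hr
  have step : ∀ x, toUh ψ x = 0 → ∃ i ∈ I, ∃ z, toUh ψ z = 0 ∧
      x = i + (PowerSeries.X : K⟦X⟧) • z := by
    intro x hx
    obtain ⟨w, hw⟩ := exists_eq_C_add_X_mul x
    obtain ⟨y, hy, hxy⟩ := exists_pbwSpan_sub_mem hr0 (PowerSeries.coeff 0 x)
    obtain ⟨i, hi, z, hz⟩ := mem_addX.1 hxy
    have hx' : x = PowerSeries.C y + (i + (PowerSeries.X : K⟦X⟧) • (z + w)) := by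
      rw [smul_add, X_hsmul, X_hsmul, ← add_assoc i, ← hz, ← add_assoc, add_sub_cancel]
      exact hw
    -- Both x and i act by zero, so y, which differs from x - i by a multiple of h, acts by zero
    -- modulo h.
    have hy0 : y = 0 := by
      refine eq_zero_of_mem_pbwSpan ψ hy fun n => ?_
      have h1 := (toUh_eq_zero_iff ψ x).1 hx n
      rw [hx', map_add, map_add, (toUh_eq_zero_iff ψ i).1 (hle i hi) n, zero_add, X_hsmul, freeAct,
        hExtend_C, hExtend_X_mul] at h1
      have h2 := congrArg (PowerSeries.coeff 0) h1
      rw [map_add, PowerSeries.coeff_zero_X_mul, add_zero] at h2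
      exact h2
    rw [hy0, map_zero, zero_add] at hx'
    refine ⟨i, hi, z + w, ?_, hx'⟩
    rw [hx', map_add, hle i hi, zero_add] at hx
    exact toUh_X_pow_smul_eq_zero ψ (m := 1) (by rwa [pow_one])
  -- The cofactor z produced by `step` is again in the kernel, so the division by h can be repeated.
  have iter : ∀ (m : ℕ) (x), toUh ψ x = 0 →
      ∃ i ∈ I, ∃ z, x = i + (PowerSeries.X : K⟦X⟧) ^ m • z := by
    intro m
    induction m with
    | zero => exact fun x _ => ⟨0, zero_mem _, x, by simp⟩
    | succ m ih =>
      intro x hx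
      obtain ⟨i, hi, w, hw, rfl⟩ := step x hx
      obtain ⟨j, hj, z, rfl⟩ := ih w hw
      refine ⟨i + (PowerSeries.X : K⟦X⟧) • j, add_mem hi ?_, z, ?_⟩
      · rw [X_hsmul]
        exact Ideal.mul_mem_left _ _ hj
      · rw [pow_succ', mul_smul, smul_add, add_assoc]
  intro x hx
  let := hTopology K (FreeH K)
  have hcl : IsClosed (I : Set (FreeH K)) := isClosed_closedIdeal _
  rw [← SetLike.mem_coe, ← hcl.closure_eq]
  refine mem_hClosure_iff.2 fun m => ?_
  obtain ⟨i, hi, z, rfl⟩ := iter m x hx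
  exact ⟨i, hi, -z, by rw [smul_neg]; abel⟩

theorem coeff_zero_of_hasHSum {p : ℕ → K[X]⟦X⟧}
    (hp0 : ∀ a, PowerSeries.coeff 0 (p a) = if a = 0 then Polynomial.X else if a = 1 then 1 else 0)
    {r : FreeH K} (hr : HasHSum K (fun a => FreeH.gen K .Xm ^ a * FreeH.gen K .Xp ^ a
      * evalSeries (FreeAlgebra.ι K Gen.H) (p a)) r) :
    PowerSeries.coeff 0 r = FreeAlgebra.ι K Gen.H +
      FreeAlgebra.ι K Gen.Xm * FreeAlgebra.ι K Gen.Xp := by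
  obtain ⟨N₀, hN₀⟩ := hasHSum_series_iff.1 hr 1
  -- With N₀ + 2 terms the partial sum contains a = 0 and a = 1, the only terms that survive modulo
  -- h.
  rw [← hN₀ (N₀ + 2) (by omega) 0 (by omega), map_sum]
  have hcoeff : ∀ a, PowerSeries.coeff 0 (FreeH.gen K .Xm ^ a * FreeH.gen K .Xp ^ a
      * evalSeries (FreeAlgebra.ι K Gen.H) (p a)) =
      FreeAlgebra.ι K Gen.Xm ^ a * FreeAlgebra.ι K Gen.Xp ^ a *
        Polynomial.aeval (FreeAlgebra.ι K Gen.H) (PowerSeries.coeff 0 (p a)) := by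
    intro a
    rw [FreeH.gen, FreeH.gen, ← map_pow, ← map_pow, ← map_mul, PowerSeries.coeff_C_mul,
      coeff_evalSeries]
  simp only [hcoeff, hp0]
  rw [Finset.sum_range_succ', Finset.sum_range_succ', Finset.sum_eq_zero fun a _ => by simp]
  simp [add_comm]

end Kernel

/-! ### The theorem -/

section Main

variable {K : Type*} [Field K] [CharZero K]

/-- The isomorphism between the presented algebra and `U_h(ψ)`. -/
theorem exists_presented_equiv {ψ : Colouring K} {r : FreeH K}
    (hr : toUh ψ (FreeH.gen K .Xp * FreeH.gen K .Xm) = toUh ψ r)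
    (hr0 : PowerSeries.coeff 0 r = FreeAlgebra.ι K Gen.H +
      FreeAlgebra.ι K Gen.Xm * FreeAlgebra.ι K Gen.Xp) :
    ∃ Φ : Presented r ≃ₐ[K⟦X⟧] Uh ψ,
      ∀ g, Φ (Ideal.Quotient.mk _ (FreeH.gen K g)) = Uh.gen ψ g := by
  have hle : ∀ x ∈ closedIdeal K (relators r), toUh ψ x = 0 := closedIdeal_le_ker_toUh hr
  refine ⟨AlgEquiv.ofBijective (Ideal.Quotient.liftₐ _ (toUh ψ) hle) ⟨?_, ?_⟩, fun g => ?_⟩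
  · rw [injective_iff_map_eq_zero]
    intro x hx
    obtain ⟨x, rfl⟩ := Ideal.Quotient.mk_surjective x
    exact Ideal.Quotient.eq_zero_iff_mem.2 (ker_toUh_le_closedIdeal hr hr0 hx)
  · intro x
    obtain ⟨y, rfl⟩ := toUh_surjective ψ x
    exact ⟨Ideal.Quotient.mk _ y, rfl⟩
  · exact toUh_gen ψ g

end Main

end

end ColouredKM

open scoped PowerSeries Polynomial
theorem mainTheorem3 {K : Type*} [Field K] [CharZero K] (ψ : ColouredKM.Colouring K)
    (hψ : ColouredKM.IsRegularSeq 1 ψ.toFun) :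
    ∃ ξ : ℕ → ℤ → K⟦X⟧,
      -- `ξ` is the unique regular summable solution of `ψ ⋉ ξ = ψ[+1]`
      (ColouredKM.IsRegularSolution ψ ξ ∧ ∀ ξ', ColouredKM.IsRegularSolution ψ ξ' → ξ' = ξ) ∧
      -- the elements `ξ^a(H)` are given by `p^a ∈ K[T]⟦h⟧`
      ∃ p : ℕ → K[X]⟦X⟧, ColouredKM.Interpolates p ξ ∧
        (∀ p', ColouredKM.Interpolates p' ξ → p' = p) ∧
        -- topological generation
        ColouredKM.TopologicallyGenerates K (Set.range (ColouredKM.Uh.gen ψ)) ∧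
        -- the relations hold in `U_h(ψ)`
        ColouredKM.Uh.gen ψ .H * ColouredKM.Uh.gen ψ .Xp
            - ColouredKM.Uh.gen ψ .Xp * ColouredKM.Uh.gen ψ .H
          = 2 * ColouredKM.Uh.gen ψ .Xp ∧
        ColouredKM.Uh.gen ψ .H * ColouredKM.Uh.gen ψ .Xm
            - ColouredKM.Uh.gen ψ .Xm * ColouredKM.Uh.gen ψ .H
          = -(2 * ColouredKM.Uh.gen ψ .Xm) ∧
        ColouredKM.HasHSum K
          (fun a => ColouredKM.Uh.gen ψ .Xm ^ a * ColouredKM.Uh.gen ψ .Xp ^ a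
            * Ideal.Quotient.mk (ColouredKM.vermaIdeal ψ)
                (ColouredKM.evalSeries (ColouredKM.Ua.gen K .H) (p a)))
          (ColouredKM.Uh.gen ψ .Xp * ColouredKM.Uh.gen ψ .Xm) ∧
        -- the right-hand side of the last relation converges before passing to the quotient, and
        -- the algebra with these generators and relations is canonically isomorphic to `U_h(ψ)`
        ∃ r : ColouredKM.FreeH K,
          ColouredKM.HasHSum K
            (fun a => ColouredKM.FreeH.gen K .Xm ^ a * ColouredKM.FreeH.gen K .Xp ^ a
              * ColouredKM.evalSeries (FreeAlgebra.ι K ColouredKM.Gen.H) (p a)) r ∧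
          ∃ Φ : ColouredKM.Presented r ≃ₐ[K⟦X⟧] ColouredKM.Uh ψ,
            ∀ g, Φ (Ideal.Quotient.mk _ (ColouredKM.FreeH.gen K g)) = ColouredKM.Uh.gen ψ g := by

  obtain ⟨Ψ, hΨ⟩ := ψ.exists_isInterpolation hψ
  obtain ⟨p, hp, hp0, hsol⟩ := hΨ.exists_solution
  have hξ := hΨ.isRegularSolution hp hsol
  have hpξ := ColouredKM.interpolates_interpolated p
  obtain ⟨r, hr⟩ := ColouredKM.exists_hasHSum (K := K)
    (fun a => ColouredKM.FreeH.gen K .Xm ^ a * ColouredKM.FreeH.gen K .Xp ^ a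
      * ColouredKM.evalSeries (FreeAlgebra.ι K ColouredKM.Gen.H) (p a)) (fun i => by
    obtain ⟨N, hN⟩ := hp i
    refine ⟨N, fun a ha => ?_⟩
    rw [ColouredKM.FreeH.gen, ColouredKM.FreeH.gen, ← map_pow, ← map_pow, ← map_mul,
      PowerSeries.coeff_C_mul, ColouredKM.coeff_evalSeries, hN a ha, map_zero, mul_zero])
  have hrel : ColouredKM.toUh ψ (ColouredKM.FreeH.gen K .Xp * ColouredKM.FreeH.gen K .Xm) =
      ColouredKM.toUh ψ r := by
    rw [← sub_eq_zero, ← map_sub, ColouredKM.toUh_eq_zero_iff]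
    intro n
    rw [map_sub, sub_eq_zero]
    exact ColouredKM.freeAct_Xp_mul_Xm n hξ.2.2 hpξ hr
  refine ⟨ColouredKM.interpolated p, ⟨hξ, fun ξ' hξ' => hξ.unique hξ'⟩, p, hpξ,
    fun p' hp' => hpξ.unique hp', ColouredKM.topologicallyGenerates_gen ψ,
    ColouredKM.Uh.gen_H_Xp ψ, ColouredKM.Uh.gen_H_Xm ψ, ?_, r, hr,
    ColouredKM.exists_presented_equiv hrel (ColouredKM.coeff_zero_of_hasHSum hp0 hr)⟩
  -- K⟦h⟧-linear maps are h-adically continuous, so the convergent series in the free algebra gives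
  -- the one in U_h(ψ).
  have h := ColouredKM.HasHSum.map (ColouredKM.toUh ψ).toLinearMap hr
  simp only [AlgHom.toLinearMap_apply, ← hrel] at h
  simp only [map_mul, map_pow, ColouredKM.toUh_gen] at h
  simp only [ColouredKM.toUh_apply ψ (ColouredKM.evalSeries _ _), ColouredKM.toUha_evalSeries] at h
  exact h
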